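/- Let $(R,\mathfrak m,k)$ be a commutative noetherian local ring of Krull dimension $d$ and embedding dimension $\nu=\dim_k \mathfrak m/\mathfrak m^2$, and let $\phi:R\to R$ be a finite local ring endomorphism of finite length (i.e. $\phi(\mathfrak m)R$ is $\mathfrak m$-primary). Let $\mathrm D^b(R)$ be the bounded derived category of finitely generated $R$-modules, let $\phi_*:\mathrm D^b(R)\to \mathrm D^b(R)$ be restriction of scalars along $\phi$, applied degreewise, and let $[\phi_*k:k]$ be the degree of the residue field $k$ over itself via the endomorphism of $k$ induced by $\phi$. For $t\in\mathbb R$ and objects $X,Y$ of $\mathrm D^b(R)$, put $$\delta_t(X,Y)=\inf\Big\{\sum_{i=1}^r e^{n_it}\ \Big|\ r\ge 1,\ n_1,\dots,n_r\in\mathbb Z,\ Y\oplus Y'\in X[n_1]*\cdots*X[n_r]\text{ for some }Y'\in\mathrm D^b(R)\Big\}\in[0,\infty],$$ where $\mathcal X*\mathcal Y$ consists of the objects $Z$ that fit into an exact triangle $A\to Z\to B\to A[1]$ with $A\in\mathcal X$, $B\in\mathcal Y$. An object $G$ is a split generator if the smallest thick subcategory of $\mathrm D^b(R)$ containing $G$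 is $\mathrm D^b(R)$. The categorical entropy is $h_t(\phi_*)=\lim_{n\to\infty}\frac1n\log\delta_t(G,\phi_*^nG)\in[-\infty,\infty]$ for a split generator $G$ (with the value $-\infty$ if it is not the case that $\delta_t(G,\phi_*^nG)\ne0$ for all $n\gg0$), and the local entropy is $h_{\mathrm{loc}}(\phi)=\lim_{e\to\infty}\frac1e\log\ell_R(R/\phi^e(\mathfrak m)R)$. Suppose that $\mathrm D^b(R)$ has a split generator. Then the limit defining $h_{\mathrm{loc}}(\phi)$ exists in $\mathbb R$, and for every $t\in\mathbb R$ the limit defining $h_t(\phi_*)$ exists and does not depend on the split generator $G$, and $$h_t(\phi_*)\ \ge\ h_{\mathrm{loc}}(\phi)+\log[\phi_*k:k].$$ If moreover $u\ge1$ is an integer such that $\mathfrak m^{\nu u^e}\subseteq\phi^e(\mathfrak m)R\subseteq\mathfrak m^{u^e}$ for all $e\gg1$, then for every $t\in\mathbb R$ and every split generator $G$ of $\mathrm D^b(R)$ one has $\delta_t(G,\phi_*^eG)=\Omega\big(([\phi_*k:k]\,u^d)^e\big)$, i.e. there is a real number $C>0$ (depending on $t$ and $G$) with $\delta_t(G,\phi_*^eG)\ge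 C\,([\phi_*k:k]\,u^d)^e$ for all $e\gg1$. -/

import Mathlib

open CategoryTheory CategoryTheory.Limits CategoryTheory.Pretriangulated IsLocalRing Filter Topology
open scoped ENNReal

universe w u v

/-! ### Complexity and categorical entropy in a triangulated category -/

section Triangulated

variable {T : Type u} [Category.{v} T] [HasZeroObject T] [HasShift T ℤ] [Preadditive T]
  [∀ n : ℤ, (shiftFunctor T n).Additive] [Pretriangulated T]

/-- The strictly full subcategory on the single object `X⟦n⟧`. -/
def shiftObj (X : T) (n : ℤ) : ObjectProperty T :=
  (ObjectProperty.singleton (X⟦n⟧)).isoClosure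

/-- `shiftStar X n l` is the full subcategory `X⟦n⟧ * X⟦l₁⟧ * ⋯ * X⟦l_s⟧` (bracketed to the
left), where `l = [l₁, …, l_s]` and where `𝒳 * 𝒴` consists of the objects `Z` fitting into a
distinguished triangle `X → Z → Y → X⟦1⟧` with `X ∈ 𝒳` and `Y ∈ 𝒴`. -/
def shiftStar (X : T) (n : ℤ) (l : List ℤ) : ObjectProperty T :=
  l.foldl (fun P m => ObjectProperty.extensionProduct P (shiftObj X m)) (shiftObj X n)

/-- The complexity `δ_t(X, Y) ∈ [0, ∞]`: the infimum of the sums `∑ e^{n_i t}` over all finite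
nonempty sequences `n_1, …, n_r` such that `Y ⊕ Y' ∈ X⟦n_1⟧ * ⋯ * X⟦n_r⟧` for some `Y'`. -/
noncomputable def complexity (t : ℝ) (X Y : T) : ℝ≥0∞ :=
  sInf {s : ℝ≥0∞ | ∃ (Y' : T) (n : ℤ) (l : List ℤ), shiftStar X n l (Y ⊞ Y') ∧
    s = ENNReal.ofReal ((n :: l).map (fun m : ℤ => Real.exp (m * t))).sum}

/-- `G` is a split generator: the smallest thick subcategory containing `G` is everything. -/
def IsSplitGenerator (G : T) : Prop :=
  (ObjectProperty.singleton G).IsClassicalTriangulatedGenerator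

/-- `δ_t(G, Φⁿ G)`. -/
noncomputable def iterComplexity (Φ : T ⥤ T) (t : ℝ) (G : T) (n : ℕ) : ℝ≥0∞ :=
  complexity t G (Φ.obj^[n] G)

open Classical in
/-- The categorical entropy of `Φ` computed with the split generator `G`: the limit of
`(1/n) log δ_t(G, Φⁿ G)` if these complexities are eventually nonzero, and `-∞` otherwise. -/
noncomputable def entropyWith (Φ : T ⥤ T) (t : ℝ) (G : T) : EReal :=
  if ∀ᶠ n : ℕ in atTop, iterComplexity Φ t G n ≠ 0 then
    limUnder atTop (fun n : ℕ => ENNReal.log (iterComplexity Φ t G n) / (n : EReal))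
  else ⊥

/-- The categorical entropy `h_t(Φ)` of an endofunctor of a triangulated category that has a
split generator (computed with some split generator). -/
noncomputable def categoricalEntropy (hT : ∃ G : T, IsSplitGenerator G) (Φ : T ⥤ T) (t : ℝ) :
    EReal :=
  entropyWith Φ t hT.choose

end Triangulated

/-! ### The bounded derived category of finitely generated modules and pushforward -/

section Pushforward

variable {R S : Type u} [CommRing R] [CommRing S]

/-- Restriction of scalars along a finite ring homomorphism, on finitely generated modules. -/
noncomputable def fgPushforward (f : R →+* S) (hf : f.Finite) :
    FGModuleCat.{u} S ⥤ FGModuleCat.{u} R :=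
  (ModuleCat.isFG R).lift ((ModuleCat.isFG S).ι ⋙ ModuleCat.restrictScalars.{u} f) (fun M => by
    let _ := f.toAlgebra
    have _ : Module.Finite R S := hf
    have _ : Module.Finite S M.obj := M.property
    let _ : Module R M.obj := Module.compHom M.obj f
    have _ : IsScalarTower R S M.obj := ⟨fun r s m => by
      change (f r * s) • m = f r • s • m
      rw [mul_smul]⟩
    change Module.Finite R M.obj
    exact Module.Finite.trans S M.obj)

variable [IsNoetherianRing R] [IsNoetherianRing S]

instance fgPushforward_additive (f : R →+* S) (hf : f.Finite) : (fgPushforward f hf).Additive where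
  map_add := rfl

instance fgPushforward_preservesFiniteLimits (f : R →+* S) (hf : f.Finite) :
    PreservesFiniteLimits (fgPushforward f hf) := by
  have _ : PreservesFiniteLimits (fgPushforward f hf ⋙ forget₂ (FGModuleCat.{u} R) (ModuleCat.{u} R)) :=
    inferInstanceAs (PreservesFiniteLimits
      (forget₂ (FGModuleCat.{u} S) (ModuleCat.{u} S) ⋙ ModuleCat.restrictScalars.{u} f))
  exact preservesFiniteLimits_of_reflects_of_preserves _
    (forget₂ (FGModuleCat.{u} R) (ModuleCat.{u} R))

instance fgPushforward_preservesFiniteColimits (f : R →+* S) (hf : f.Finite) :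
    PreservesFiniteColimits (fgPushforward f hf) := by
  have _ : PreservesFiniteColimits
      (fgPushforward f hf ⋙ forget₂ (FGModuleCat.{u} R) (ModuleCat.{u} R)) :=
    inferInstanceAs (PreservesFiniteColimits
      (forget₂ (FGModuleCat.{u} S) (ModuleCat.{u} S) ⋙ ModuleCat.restrictScalars.{u} f))
  exact preservesFiniteColimits_of_reflects_of_preserves _
    (forget₂ (FGModuleCat.{u} R) (ModuleCat.{u} R))

variable [HasDerivedCategory.{w} (FGModuleCat.{u} R)] [HasDerivedCategory.{w} (FGModuleCat.{u} S)]

variable (R) in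
/-- `D^b(R)`, the bounded derived category of the abelian category of finitely generated
`R`-modules. -/
abbrev DbMod : Type (u + 1) := DerivedCategory.Bounded (FGModuleCat.{u} R)

theorem bounded_mapDerivedCategory (f : R →+* S) (hf : f.Finite) (X : DbMod S) :
    (DerivedCategory.TStructure.t (C := FGModuleCat.{u} R)).bounded
      ((fgPushforward f hf).mapDerivedCategory.obj X.obj) := by
  obtain ⟨⟨a, _⟩, ⟨b, _⟩⟩ := X.property
  obtain ⟨K, _, _, ⟨e⟩⟩ := DerivedCategory.exists_iso_Q_obj_of_isGE_of_isLE X.obj a b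
  let F := fgPushforward f hf
  let L : CochainComplex (FGModuleCat.{u} R) ℤ := (F.mapHomologicalComplex (ComplexShape.up ℤ)).obj K
  have hGE : L.IsStrictlyGE a := by
    rw [CochainComplex.isStrictlyGE_iff]
    intro i hi
    exact F.map_isZero (K.isZero_of_isStrictlyGE a i hi)
  have hLE : L.IsStrictlyLE b := by
    rw [CochainComplex.isStrictlyLE_iff]
    intro i hi
    exact F.map_isZero (K.isZero_of_isStrictlyLE b i hi)
  have e' : DerivedCategory.Q.obj L ≅ F.mapDerivedCategory.obj X.obj :=
    (F.mapDerivedCategoryFactors.app K).symm ≪≫ F.mapDerivedCategory.mapIso e.symm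
  exact ⟨⟨a, DerivedCategory.TStructure.t.isGE_of_iso e' a⟩,
    ⟨b, DerivedCategory.TStructure.t.isLE_of_iso e' b⟩⟩

/-- The pushforward `f_* : D^b(S) ⥤ D^b(R)` along a finite ring homomorphism `f : R → S`,
given by degreewise restriction of scalars. -/
noncomputable def pushforward (f : R →+* S) (hf : f.Finite) : DbMod S ⥤ DbMod R :=
  ObjectProperty.lift _
    (DerivedCategory.Bounded.ι ⋙ (fgPushforward f hf).mapDerivedCategory)
    (fun X => bounded_mapDerivedCategory f hf X)

end Pushforward

/-! ### Local entropy -/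

section Local

variable {R : Type u} [CommRing R] [IsLocalRing R]

/-- A local homomorphism of local rings is of finite length if the extension of the maximal
ideal of the source is primary to the maximal ideal of the target. -/
def IsOfFiniteLength {S : Type u} [CommRing S] [IsLocalRing S] (φ : R →+* S) : Prop :=
  ((maximalIdeal R).map φ).IsPrimary ∧ ((maximalIdeal R).map φ).radical = maximalIdeal S

/-- `(1/e) log ℓ_R(R / φ^e(𝔪)R)`. -/
noncomputable def localEntropySeq (φ : R →+* R) (e : ℕ) : ℝ :=
  Real.log (Module.length R (R ⧸ (maximalIdeal R).map (φ ^ e))).toNat / e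

/-- The local entropy `h_loc(φ)`. -/
noncomputable def localEntropy (φ : R →+* R) : ℝ :=
  limUnder atTop (localEntropySeq φ)

/-- `[φ_* k : k]`, the dimension over `k` of the residue field `k` with the module structure
through the endomorphism of `k` induced by `φ`. -/
noncomputable def residueDegree (φ : R →+* R) [IsLocalHom φ] : ℕ :=
  @Module.finrank (ResidueField R) (ResidueField R) _ _
    (Module.compHom (ResidueField R) (ResidueField.map φ))

end Local

/-!
The proof bounds complexities from below by additive invariants. Call a `[0, ∞]`-valued function `f`
on the objects of a triangulated category shift-subadditive (`IsShiftSubadditive t f`) if it is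
subadditive on triangles, monotone on retracts and multiplied by at most `e ^ (n * t)` by the shift
`⟦n⟧`. Unwinding the definition of `δ_t` gives `f Z / f Y ≤ δ_t(Y, Z)`
(`IsShiftSubadditive.div_le_complexity`). The function `δ_t(X, ·)` is itself of this kind, by
associativity of the extension product (the octahedral axiom), and so is `δ_t(Φ X, Φ ·)` for a
triangulated functor `Φ`. Hence the triangle inequality `δ_t(X, Z) ≤ δ_t(X, Y) δ_t(Y, Z)`, the
inequality `δ_t(Φ X, Φ Y) ≤ δ_t(X, Y)` and the finiteness of `δ_t(G, ·)` for a split generator `G`.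
So `n ↦ δ_t(G, Φⁿ G)` is submultiplicative, and as soon as it is bounded away from zero Fekete's
lemma yields a real limit, the same for all split generators (`exists_categoricalEntropy_eq`).

For the lower bound let `P` be the Koszul complex on generators `x₁, …, x_r` of `𝔪`, built as an
iterated cone of `x_i • 𝟙` starting from `R` (`exists_koszul`). The function
`f X = ∑ᵢ e^(-it) ℓ_R(Hom(P, X⟦i⟧))` is shift-subadditive because `Hom(P, ·)` is homological. It is
finite on `D^b(R)`, because the total Hom module is finitely generated and the `x_i` act nilpotently
on `P`. On a module `N` the top term `Hom(P, N⟦r⟧)` is `N ⧸ 𝔪 N`. Applied to `N = φ_*^e R` this gives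
`f (φ_*^e R) ≥ c [φ_*k : k]^e ℓ_R(R ⧸ φ^e(𝔪)R)`, and since
`δ_t(G, φ_*^e R) ≤ δ_t(G, φ_*^e G) δ_t(G, R)` the same bound, with another constant, holds for
`δ_t(G, φ_*^e G)` (`exists_mul_length_le_iterComplexity`).

The lengths `ℓ_R(R ⧸ φ^e(𝔪)R)` are submultiplicative, since base change along `φ^e` multiplies lengths
at most by the length of the closed fibre; so the local entropy exists, and the inequality of
entropies follows. If `φ^e(𝔪)R ⊆ 𝔪^(u^e)`, these lengths are at least those of `R ⧸ 𝔪^(u^e)`, which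
are bounded below by a multiple of `(u^e)^d`: for a prime `P` and `x ∉ P` the Hilbert–Samuel
functions satisfy `H_P(n) ≥ H_P(n - k) + H_{P + (x)}(n)` by the Artin–Rees lemma, and summation along
a chain of primes of length `d` gives the claim (`exists_pow_le_mul_length_quotient_pow`).
-/

/-! ### Complexity and shift-subadditive functions -/

section Triangulated

variable {T : Type u} [Category.{v} T] [HasZeroObject T] [HasShift T ℤ] [Preadditive T]
  [∀ n : ℤ, (shiftFunctor T n).Additive] [Pretriangulated T]

/-- A `[0, ∞]`-valued function on the objects of a triangulated category that is subadditive along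
distinguished triangles, monotone along retracts, and multiplied by at most `e ^ (n * t)` by the
shift `⟦n⟧`. -/
structure IsShiftSubadditive (t : ℝ) (f : T → ℝ≥0∞) : Prop where
  le_add : ∀ A ∈ distTriang T, f A.obj₂ ≤ f A.obj₁ + f A.obj₃
  shift_le : ∀ (X : T) (n : ℤ), f (X⟦n⟧) ≤ ENNReal.ofReal (Real.exp (n * t)) * f X
  retract_le : ∀ {X Y : T}, Retract X Y → f X ≤ f Y

lemma IsShiftSubadditive.comp {T' : Type*} [Category* T'] [HasZeroObject T'] [HasShift T' ℤ]
    [Preadditive T'] [∀ n : ℤ, (shiftFunctor T' n).Additive] [Pretriangulated T'] {t : ℝ}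
    {f : T → ℝ≥0∞} (hf : IsShiftSubadditive t f) (Φ : T' ⥤ T) [Φ.CommShift ℤ] [Φ.IsTriangulated] :
    IsShiftSubadditive t (fun X => f (Φ.obj X)) where
  le_add A hA := hf.le_add _ (Φ.map_distinguished A hA)
  shift_le X n := (hf.retract_le (.ofIso ((Φ.commShiftIso n).app X))).trans (hf.shift_le _ _)
  retract_le h := hf.retract_le (h.map Φ)

lemma IsShiftSubadditive.le_weight_mul {t : ℝ} {f : T → ℝ≥0∞} (hf : IsShiftSubadditive t f)
    {Y : T} {n : ℤ} {l : List ℤ} {Z : T} (hZ : shiftStar Y n l Z) :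
    f Z ≤ ENNReal.ofReal ((n :: l).map (fun m : ℤ => Real.exp (m * t))).sum * f Y := by
  have key : ∀ {m : ℤ} {Z : T}, shiftObj Y m Z →
      f Z ≤ ENNReal.ofReal (Real.exp (m * t)) * f Y := by
    rintro m Z ⟨W, hW, ⟨e⟩⟩
    obtain rfl : Y⟦m⟧ = W := by simpa using hW
    exact (hf.retract_le (.ofIso e)).trans (hf.shift_le _ _)
  induction l using List.reverseRecOn generalizing Z with
  | nil => simpa using key hZ
  | append_singleton l a ih =>
    simp only [shiftStar, List.foldl_append, List.foldl_cons, List.foldl_nil] at hZ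
    obtain ⟨A, B, g, h, k, hT, hA, hB⟩ := hZ
    have h1 := hf.le_add _ hT
    have h2 := ih hA
    have h3 := key hB
    rw [← List.cons_append, List.map_append, List.sum_append, ENNReal.ofReal_add, add_mul]
    · simpa using h1.trans (add_le_add h2 h3)
    · exact List.sum_nonneg (by simp; exact ⟨by positivity, fun _ _ => by positivity⟩)
    · simpa using by positivity

/-- A functional as above bounds the complexity from below. The quotient conventions of `[0, ∞]` are
such that no finiteness or nonvanishing is needed. -/
lemma IsShiftSubadditive.div_le_complexity {t : ℝ} {f : T → ℝ≥0∞} (hf : IsShiftSubadditive t f)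
    (Y Z : T) : f Z / f Y ≤ complexity t Y Z := by
  refine le_sInf ?_
  rintro s ⟨Z', n, l, h, rfl⟩
  refine ENNReal.div_le_of_le_mul ((hf.retract_le ?_).trans (hf.le_weight_mul h))
  exact { i := biprod.inl, r := biprod.fst }

/-- Being a retract of an object of a strictly full subcategory `P` is the same as being a direct
summand, because split monomorphisms have complements in a triangulated category. -/
lemma retractClosure_iff_biprod (P : ObjectProperty T) [P.IsClosedUnderIsomorphisms] (Y : T) :
    P.retractClosure Y ↔ ∃ Y', P (Y ⊞ Y') := by
  constructor
  · rintro ⟨Z, hZ, ⟨r⟩⟩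
    obtain ⟨C, g, h, hT⟩ := distinguished_cocone_triangle r.i
    have h0 : h = 0 := by
      have h1 := comp_distTriang_mor_zero₃₁ _ hT
      have : IsSplitMono (r.i⟦(1 : ℤ)⟧') := ⟨⟨⟨r.r⟦(1 : ℤ)⟧', by
        rw [← Functor.map_comp, r.retract, CategoryTheory.Functor.map_id]⟩⟩⟩
      exact (cancel_mono (r.i⟦(1 : ℤ)⟧')).1 (h1.trans zero_comp.symm)
    obtain ⟨e, -, -⟩ := exists_iso_binaryBiproduct_of_distTriang _ hT h0
    exact ⟨C, P.prop_of_iso e hZ⟩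
  · rintro ⟨Y', h⟩
    exact ⟨_, h, ⟨{ i := biprod.inl, r := biprod.fst }⟩⟩

instance (X : T) (n : ℤ) : (shiftObj X n).IsClosedUnderIsomorphisms := by
  unfold shiftObj; infer_instance

instance (X : T) (n : ℤ) (l : List ℤ) : (shiftStar X n l).IsClosedUnderIsomorphisms := by
  induction l using List.reverseRecOn with
  | nil => exact inferInstanceAs (shiftObj X n).IsClosedUnderIsomorphisms
  | append_singleton l a ih =>
    simp only [shiftStar, List.foldl_append, List.foldl_cons, List.foldl_nil]
    infer_instance

lemma shiftStar_concat (X : T) (n : ℤ) (l : List ℤ) (a : ℤ) :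
    shiftStar X n (l ++ [a]) = (shiftStar X n l).extensionProduct (shiftObj X a) := by
  simp [shiftStar, List.foldl_append]

lemma extensionProduct_shiftStar [IsTriangulated T] (X : T) (n : ℤ) (l : List ℤ) (m : ℤ)
    (k : List ℤ) : (shiftStar X n l).extensionProduct (shiftStar X m k) =
      shiftStar X n (l ++ m :: k) := by
  induction k using List.reverseRecOn with
  | nil => rw [shiftStar_concat]; rfl
  | append_singleton k a ih =>
    rw [shiftStar_concat, ← ObjectProperty.extensionProduct_assoc, ih, ← shiftStar_concat]
    simp

lemma shiftStar_shift (X : T) (n : ℤ) (l : List ℤ) (a : ℤ) {Z : T} (hZ : shiftStar X n l Z) :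
    shiftStar X (n + a) (l.map (· + a)) (Z⟦a⟧) := by
  have key : ∀ {m : ℤ} {Z : T}, shiftObj X m Z → shiftObj X (m + a) (Z⟦a⟧) := by
    rintro m Z ⟨W, hW, ⟨e⟩⟩
    obtain rfl : X⟦m⟧ = W := by simpa using hW
    exact ⟨X⟦m + a⟧, by simp, ⟨(shiftFunctor T a).mapIso e ≪≫ (shiftFunctorAdd T m a).symm.app X⟩⟩
  induction l using List.reverseRecOn generalizing Z with
  | nil => exact key hZ
  | append_singleton l b ih =>
    rw [shiftStar_concat] at hZ
    obtain ⟨A, B, g, h, k, hT, hA, hB⟩ := hZ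
    rw [List.map_append, List.map_singleton, shiftStar_concat]
    exact ⟨_, _, _, _, _, Triangle.shift_distinguished _ hT a, ih hA, key hB⟩

lemma complexity_le_of_retractClosure {t : ℝ} {X Y : T} {n : ℤ} {l : List ℤ}
    (h : (shiftStar X n l).retractClosure Y) :
    complexity t X Y ≤ ENNReal.ofReal ((n :: l).map (fun m : ℤ => Real.exp (m * t))).sum := by
  obtain ⟨Y', h⟩ := (retractClosure_iff_biprod _ _).1 h
  exact sInf_le ⟨Y', n, l, h, rfl⟩

lemma complexity_le_add_of_distTriang [IsTriangulated T] (t : ℝ) (X : T) {A : Triangle T}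
    (hA : A ∈ distTriang T) :
    complexity t X A.obj₂ ≤ complexity t X A.obj₁ + complexity t X A.obj₃ := by
  conv_rhs => rw [complexity, complexity]
  rw [ENNReal.sInf_add]
  refine le_iInf₂ ?_
  rintro _ ⟨Y₁, n, l, h₁, rfl⟩
  rw [add_comm, ENNReal.sInf_add]
  refine le_iInf₂ ?_
  rintro _ ⟨Y₃, m, k, h₃, rfl⟩
  have : (shiftStar X n (l ++ m :: k)).retractClosure A.obj₂ := by
    rw [← extensionProduct_shiftStar]
    exact ObjectProperty.extensionProduct_retractClosure_retractClosure_le _ _ _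
      ⟨_, _, _, _, _, hA, (retractClosure_iff_biprod _ _).2 ⟨_, h₁⟩,
        (retractClosure_iff_biprod _ _).2 ⟨_, h₃⟩⟩
  refine (complexity_le_of_retractClosure this).trans ?_
  rw [add_comm, ← ENNReal.ofReal_add, ← List.sum_append, ← List.map_append, List.cons_append]
  all_goals exact List.sum_nonneg (by simp; exact ⟨by positivity, fun _ _ => by positivity⟩)

lemma complexity_shift_le (t : ℝ) (X Y : T) (a : ℤ) :
    complexity t X (Y⟦a⟧) ≤ ENNReal.ofReal (Real.exp (a * t)) * complexity t X Y := by
  conv_rhs => rw [complexity]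
  rw [sInf_eq_iInf', ENNReal.mul_iInf_of_ne (by simp [Real.exp_pos]) (by simp)]
  refine le_iInf ?_
  rintro ⟨_, Y', n, l, h, rfl⟩
  have h2 : (shiftStar X (n + a) (l.map (· + a))).retractClosure (Y⟦a⟧) :=
    ⟨_, shiftStar_shift X n l a h,
      ⟨(show Retract Y (Y ⊞ Y') from { i := biprod.inl, r := biprod.fst }).map (shiftFunctor T a)⟩⟩
  refine (complexity_le_of_retractClosure h2).trans_eq ?_
  rw [← ENNReal.ofReal_mul (by positivity), ← List.map_cons (f := (· + a)), List.map_map,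
    ← List.sum_map_mul_left]
  congr 3
  ext m
  simp only [Function.comp, ← Real.exp_add]
  push_cast
  ring_nf

lemma isShiftSubadditive_complexity [IsTriangulated T] (t : ℝ) (X : T) :
    IsShiftSubadditive t (complexity t X) where
  le_add _ hA := complexity_le_add_of_distTriang t X hA
  shift_le Y n := complexity_shift_le t X Y n
  retract_le {Y Z} r := by
    refine le_sInf ?_
    rintro _ ⟨Z', n, l, h, rfl⟩
    exact complexity_le_of_retractClosure
      ⟨_, h, ⟨r.trans { i := biprod.inl, r := biprod.fst }⟩⟩

lemma complexity_self_le (t : ℝ) (X : T) : complexity t X X ≤ 1 := by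
  have : (shiftStar X 0 []).retractClosure X :=
    ObjectProperty.le_retractClosure _ _ ⟨X⟦(0 : ℤ)⟧, by simp, ⟨((shiftFunctorZero T ℤ).app X).symm⟩⟩
  simpa using complexity_le_of_retractClosure (t := t) this

/-- A functional that is finite on a split generator is finite everywhere. -/
lemma IsShiftSubadditive.ne_top [IsTriangulated T] {t : ℝ} {f : T → ℝ≥0∞}
    (hf : IsShiftSubadditive t f) {G : T} (hG : IsSplitGenerator G) (h : f G ≠ ∞) (X : T) :
    f X ≠ ∞ := by
  let Q : ObjectProperty T := fun X => f X ≠ ∞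
  have : Q.IsStableUnderRetracts :=
    ⟨fun r hY => ((hf.retract_le r).trans_lt (lt_top_iff_ne_top.2 hY)).ne⟩
  have : Q.IsTriangulated :=
    { exists_zero := by
        refine ⟨_, isZero_zero _, ?_⟩
        exact ((hf.retract_le (show Retract _ G from { i := 0, r := 0, retract := (isZero_zero T).eq_of_src _ _ })).trans_lt
          (lt_top_iff_ne_top.2 h)).ne
      isStableUnderShiftBy := fun a => ⟨fun Y hY =>
        ((hf.shift_le Y a).trans_lt (ENNReal.mul_lt_top (by simp) (lt_top_iff_ne_top.2 hY))).ne⟩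
      toIsTriangulatedClosed₂ := .mk' fun A hA h₁ h₃ =>
        ((hf.le_add A hA).trans_lt (ENNReal.add_lt_top.2
          ⟨lt_top_iff_ne_top.2 h₁, lt_top_iff_ne_top.2 h₃⟩)).ne }
  have hle : (ObjectProperty.singleton G).triangEnvelope ≤ Q := by
    rw [ObjectProperty.triangEnvelope_le_iff]
    intro Y hY
    obtain rfl : G = Y := by simpa using hY
    exact h
  rw [hG] at hle
  exact hle X trivial

lemma complexity_ne_top [IsTriangulated T] (t : ℝ) {G : T} (hG : IsSplitGenerator G) (X : T) :
    complexity t G X ≠ ∞ :=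
  (isShiftSubadditive_complexity t G).ne_top hG
    ((complexity_self_le t G).trans_lt ENNReal.one_lt_top).ne X

lemma complexity_le_mul [IsTriangulated T] (t : ℝ) {X Y Z : T} (hY : complexity t X Y ≠ ∞)
    (hYZ : complexity t Y Z ≠ ∞) : complexity t X Z ≤ complexity t X Y * complexity t Y Z := by
  have := (isShiftSubadditive_complexity t X).div_le_complexity Y Z
  rwa [ENNReal.div_le_iff_le_mul (.inr hYZ) (.inl hY), mul_comm] at this

lemma complexity_map_le [IsTriangulated T] (t : ℝ) (Φ : T ⥤ T) [Φ.CommShift ℤ] [Φ.IsTriangulated]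
    (X Y : T) : complexity t (Φ.obj X) (Φ.obj Y) ≤ complexity t X Y := by
  have := ((isShiftSubadditive_complexity t (Φ.obj X)).comp Φ).div_le_complexity X Y
  refine le_trans ?_ this
  conv_lhs => rw [← div_one (complexity t (Φ.obj X) (Φ.obj Y))]
  exact ENNReal.div_le_div_left (complexity_self_le _ _) _

lemma complexity_iterate_le [IsTriangulated T] (t : ℝ) (Φ : T ⥤ T) [Φ.CommShift ℤ]
    [Φ.IsTriangulated] (X Y : T) (n : ℕ) :
    complexity t (Φ.obj^[n] X) (Φ.obj^[n] Y) ≤ complexity t X Y := by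
  induction n with
  | zero => rfl
  | succ n ih =>
    rw [Function.iterate_succ_apply', Function.iterate_succ_apply']
    exact (complexity_map_le t Φ _ _).trans ih

lemma iterComplexity_add_le [IsTriangulated T] (t : ℝ) (Φ : T ⥤ T) [Φ.CommShift ℤ]
    [Φ.IsTriangulated] {G : T} (hG : IsSplitGenerator G) (m n : ℕ) :
    iterComplexity Φ t G (m + n) ≤ iterComplexity Φ t G m * iterComplexity Φ t G n := by
  have h : complexity t (Φ.obj^[m] G) (Φ.obj^[m + n] G) ≤ iterComplexity Φ t G n := by
    rw [Function.iterate_add_apply]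
    exact complexity_iterate_le t Φ G _ m
  refine (complexity_le_mul t (complexity_ne_top t hG _)
    (h.trans_lt (lt_top_iff_ne_top.2 (complexity_ne_top t hG _))).ne).trans ?_
  exact mul_le_mul_right h _

/-- The complexities computed with two split generators differ by a bounded factor. -/
lemma exists_iterComplexity_le [IsTriangulated T] (t : ℝ) (Φ : T ⥤ T) [Φ.CommShift ℤ]
    [Φ.IsTriangulated] {G G' : T} (hG : IsSplitGenerator G) (hG' : IsSplitGenerator G') :
    ∃ c : ℝ≥0∞, c ≠ ∞ ∧ ∀ n, iterComplexity Φ t G' n ≤ c * iterComplexity Φ t G n := by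
  have hfin := complexity_ne_top t hG
  have hfin' := complexity_ne_top t hG'
  refine ⟨complexity t G' G * complexity t G G', ENNReal.mul_ne_top (hfin' _) (hfin _), fun n => ?_⟩
  have h := complexity_iterate_le t Φ G G' n
  have h1 : complexity t (Φ.obj^[n] G) (Φ.obj^[n] G') ≠ ∞ :=
    (h.trans_lt (lt_top_iff_ne_top.2 (hfin _))).ne
  have h2 : complexity t G (Φ.obj^[n] G') ≤ iterComplexity Φ t G n * complexity t G G' :=
    (complexity_le_mul t (hfin _) h1).trans (mul_le_mul_right h _)
  refine (complexity_le_mul t (hfin' G) (hfin _)).trans ((mul_le_mul_right h2 _).trans_eq ?_)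
  ring

end Triangulated

/-! ### Limits of logarithmic growth rates -/

section Growth

lemma ennreal_log_div_natCast {x : ℝ≥0∞} (h0 : x ≠ 0) (h : x ≠ ∞) (n : ℕ) :
    ENNReal.log x / (n : EReal) = ((Real.log x.toReal / n : ℝ) : EReal) := by
  rw [ENNReal.log_pos_real h0 h, EReal.coe_div]; rfl

lemma tendsto_log_ennreal_div {a : ℕ → ℝ≥0∞} (h0 : ∀ n, a n ≠ 0) (hfin : ∀ n, a n ≠ ∞) {h : ℝ}
    (hlim : Tendsto (fun n : ℕ => Real.log (a n).toReal / n) atTop (𝓝 h)) :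
    Tendsto (fun n : ℕ => ENNReal.log (a n) / (n : EReal)) atTop (𝓝 (h : EReal)) := by
  simp only [ennreal_log_div_natCast (h0 _) (hfin _)]
  exact (continuous_coe_real_ereal.tendsto h).comp hlim

/-- Fekete's lemma for a submultiplicative sequence that is finite and bounded away from zero. -/
lemma exists_tendsto_log_toReal_div {a : ℕ → ℝ≥0∞} (hfin : ∀ n, a n ≠ ∞)
    (hmul : ∀ m n, a (m + n) ≤ a m * a n) {c : ℝ≥0∞} (hc : c ≠ 0) (hca : ∀ n, c ≤ a n) :
    ∃ h : ℝ, Tendsto (fun n : ℕ => Real.log (a n).toReal / n) atTop (𝓝 h) := by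
  have hpos : ∀ n, 0 < (a n).toReal := fun n =>
    ENNReal.toReal_pos ((pos_iff_ne_zero.2 hc).trans_le (hca n)).ne' (hfin n)
  have hctop : c ≠ ∞ := ((hca 0).trans_lt (lt_top_iff_ne_top.2 (hfin 0))).ne
  have hsub : Subadditive fun n => Real.log (a n).toReal := fun m n => by
    rw [← Real.log_mul (hpos m).ne' (hpos n).ne', ← ENNReal.toReal_mul]
    exact Real.log_le_log (hpos _)
      (ENNReal.toReal_mono (ENNReal.mul_ne_top (hfin m) (hfin n)) (hmul m n))
  refine ⟨_, hsub.tendsto_lim ⟨-|Real.log c.toReal|, ?_⟩⟩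
  rintro _ ⟨n, rfl⟩
  have h1 : Real.log c.toReal ≤ Real.log (a n).toReal :=
    Real.log_le_log (ENNReal.toReal_pos hc hctop) (ENNReal.toReal_mono (hfin n) (hca n))
  rcases Nat.eq_zero_or_pos n with rfl | hn
  · simp
  · have hn1 : (1 : ℝ) ≤ n := by exact_mod_cast hn
    change _ ≤ Real.log (a n).toReal / n
    rw [le_div_iff₀ (by positivity)]
    nlinarith [neg_abs_le (Real.log c.toReal), abs_nonneg (Real.log c.toReal)]

lemma limit_log_toReal_div_le {a b : ℕ → ℝ≥0∞} (ha0 : ∀ n, a n ≠ 0) (hb0 : ∀ n, b n ≠ 0)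
    (hb : ∀ n, b n ≠ ∞) {c : ℝ≥0∞} (hc : c ≠ ∞) (hab : ∀ n, a n ≤ c * b n) {x y : ℝ}
    (hx : Tendsto (fun n : ℕ => Real.log (a n).toReal / n) atTop (𝓝 x))
    (hy : Tendsto (fun n : ℕ => Real.log (b n).toReal / n) atTop (𝓝 y)) : x ≤ y := by
  have hc0 : c ≠ 0 := by rintro rfl; exact ha0 0 (by simpa using hab 0)
  have h1 := (tendsto_const_div_atTop_nhds_zero_nat (Real.log c.toReal)).add hy
  rw [zero_add] at h1
  refine le_of_tendsto_of_tendsto' hx h1 fun n => ?_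
  rw [← add_div, ← Real.log_mul (ENNReal.toReal_pos hc0 hc).ne'
    (ENNReal.toReal_pos (hb0 n) (hb n)).ne', ← ENNReal.toReal_mul]
  have hcb : c * b n ≠ ∞ := ENNReal.mul_ne_top hc (hb n)
  gcongr
  · exact ENNReal.toReal_pos (ha0 n) (((hab n).trans_lt (lt_top_iff_ne_top.2 hcb)).ne)
  · exact hab n

end Growth

section Entropy

variable {T : Type u} [Category.{v} T] [HasZeroObject T] [HasShift T ℤ] [Preadditive T]
  [∀ n : ℤ, (shiftFunctor T n).Additive] [Pretriangulated T]

/-- If the complexities `δ_t(G, Φⁿ G)` are bounded away from zero, the categorical entropy is a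
real number, and it is the limit computed with any split generator. -/
theorem exists_categoricalEntropy_eq [IsTriangulated T] (hT : ∃ G : T, IsSplitGenerator G)
    (Φ : T ⥤ T) [Φ.CommShift ℤ] [Φ.IsTriangulated] (t : ℝ)
    (hpos : ∀ G : T, IsSplitGenerator G → ∃ c : ℝ≥0∞, c ≠ 0 ∧ ∀ n, c ≤ iterComplexity Φ t G n) :
    ∃ h : ℝ, categoricalEntropy hT Φ t = h ∧ ∀ G : T, IsSplitGenerator G →
      Tendsto (fun n : ℕ => Real.log (iterComplexity Φ t G n).toReal / n) atTop (𝓝 h) := by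
  have hfin : ∀ G : T, IsSplitGenerator G → ∀ n, iterComplexity Φ t G n ≠ ∞ :=
    fun G hG n => complexity_ne_top t hG _
  have h0 : ∀ G : T, IsSplitGenerator G → ∀ n, iterComplexity Φ t G n ≠ 0 := fun G hG n => by
    obtain ⟨c, hc, hcn⟩ := hpos G hG
    exact ((pos_iff_ne_zero.2 hc).trans_le (hcn n)).ne'
  have hlim : ∀ G : T, IsSplitGenerator G → ∃ h : ℝ,
      Tendsto (fun n : ℕ => Real.log (iterComplexity Φ t G n).toReal / n) atTop (𝓝 h) := by
    intro G hG
    obtain ⟨c, hc, hcn⟩ := hpos G hG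
    exact exists_tendsto_log_toReal_div (hfin G hG) (iterComplexity_add_le t Φ hG) hc hcn
  have hG₀ := hT.choose_spec
  obtain ⟨h, hh⟩ := hlim _ hG₀
  refine ⟨h, ?_, fun G hG => ?_⟩
  · rw [categoricalEntropy, entropyWith, if_pos (.of_forall (h0 _ hG₀))]
    exact (tendsto_log_ennreal_div (h0 _ hG₀) (hfin _ hG₀) hh).limUnder_eq
  · obtain ⟨h', hh'⟩ := hlim G hG
    obtain ⟨c, hc, hcn⟩ := exists_iterComplexity_le t Φ hG₀ hG
    obtain ⟨c', hc', hcn'⟩ := exists_iterComplexity_le t Φ hG hG₀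
    have h1 := limit_log_toReal_div_le (h0 _ hG) (h0 _ hG₀) (hfin _ hG₀) hc hcn hh' hh
    have h2 := limit_log_toReal_div_le (h0 _ hG₀) (h0 _ hG) (hfin _ hG) hc' hcn' hh hh'
    rwa [le_antisymm h2 h1]

end Entropy

/-! ### Graded lengths of Hom modules -/

section HomLength

lemma subsingleton_of_exact {R M N Q : Type*} [Ring R] [AddCommGroup M] [AddCommGroup N]
    [AddCommGroup Q] [Module R M] [Module R N] [Module R Q] {f : M →ₗ[R] N} {g : N →ₗ[R] Q}
    (h : Function.Exact f g) [Subsingleton M] [Subsingleton Q] : Subsingleton N := by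
  refine subsingleton_of_forall_eq 0 fun y => ?_
  obtain ⟨x, rfl⟩ := (h y).1 (Subsingleton.elim _ _)
  rw [Subsingleton.elim x 0, map_zero]

lemma length_le_add_of_exact {R M N Q : Type*} [Ring R] [AddCommGroup M] [AddCommGroup N]
    [AddCommGroup Q] [Module R M] [Module R N] [Module R Q] (f : M →ₗ[R] N) (g : N →ₗ[R] Q)
    (h : Function.Exact f g) : Module.length R N ≤ Module.length R M + Module.length R Q := by
  rw [Module.length_eq_add_of_exact (LinearMap.range f).subtype g.rangeRestrict
    Subtype.coe_injective g.surjective_rangeRestrict]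
  · exact add_le_add (Module.length_le_of_surjective f.rangeRestrict f.surjective_rangeRestrict)
      (Module.length_le_of_injective _ (LinearMap.range g).injective_subtype)
  · intro y
    simpa [Subtype.ext_iff] using h y

variable (R : Type*) [CommRing R] {D : Type u} [Category.{v} D] [Preadditive D] [Linear R D]
  [HasShift D ℤ]

variable {R} in
/-- The linear equivalence on morphisms into isomorphic objects. -/
def homCongrRight (P : D) {X Y : D} (e : X ≅ Y) : (P ⟶ X) ≃ₗ[R] (P ⟶ Y) :=
  { Linear.rightComp R P e.hom with
    invFun := fun f => f ≫ e.inv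
    left_inv := fun f => by simp
    right_inv := fun f => by simp }

/-- The graded length `∑ᵢ e^(-it) ℓ_R(Hom(P, X⟦i⟧))`, with values in `[0, ∞]`. -/
noncomputable def homWeight (t : ℝ) (P X : D) : ℝ≥0∞ :=
  ∑' i : ℤ, ENNReal.ofReal (Real.exp (-(i * t))) * ((Module.length R (P ⟶ X⟦i⟧) : ℕ∞) : ℝ≥0∞)

lemma le_homWeight (t : ℝ) (P X : D) (i : ℤ) :
    ENNReal.ofReal (Real.exp (-(i * t))) * ((Module.length R (P ⟶ X⟦i⟧) : ℕ∞) : ℝ≥0∞) ≤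
      homWeight R t P X :=
  ENNReal.le_tsum i

/-- The total Hom module `⨁ᵢ Hom(P, X⟦i⟧)` is a noetherian `R`-module. -/
structure IsHomNoetherian (P X : D) : Prop where
  isNoetherian : ∀ i : ℤ, IsNoetherian R (P ⟶ X⟦i⟧)
  finite : {i : ℤ | ¬ Subsingleton (P ⟶ X⟦i⟧)}.Finite

variable {R}

lemma homWeight_ne_top {P X : D} (h : IsHomNoetherian R P X)
    (hlen : ∀ i : ℤ, Module.length R (P ⟶ X⟦i⟧) ≠ ⊤) (t : ℝ) : homWeight R t P X ≠ ∞ := by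
  rw [homWeight, tsum_eq_sum (s := h.finite.toFinset)]
  · exact ENNReal.sum_ne_top.2 fun i _ => ENNReal.mul_ne_top (by simp) (by simpa using hlen i)
  · intro i hi
    have : Subsingleton (P ⟶ X⟦i⟧) := by simpa using hi
    simp [Module.length_eq_zero]

namespace IsHomNoetherian

lemma of_iso {P X Y : D} (e : X ≅ Y) (h : IsHomNoetherian R P X) : IsHomNoetherian R P Y where
  isNoetherian i := by
    have := h.isNoetherian i
    exact isNoetherian_of_linearEquiv (homCongrRight (R := R) P ((shiftFunctor D i).mapIso e))
  finite := h.finite.subset fun i hi hs =>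
    hi (homCongrRight (R := R) P ((shiftFunctor D i).mapIso e)).symm.subsingleton

lemma shift {P X : D} (h : IsHomNoetherian R P X) (n : ℤ) : IsHomNoetherian R P (X⟦n⟧) where
  isNoetherian i := by
    have := h.isNoetherian (n + i)
    exact isNoetherian_of_linearEquiv (homCongrRight (R := R) P (shiftAdd X n i))
  finite := (h.finite.preimage (add_right_injective n).injOn).subset fun i hi hs =>
    hi (homCongrRight (R := R) P (shiftAdd X n i)).symm.subsingleton

end IsHomNoetherian

section Pretriangulated

variable [HasZeroObject D] [∀ n : ℤ, (shiftFunctor D n).Additive] [Pretriangulated D]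

variable (R) in
lemma exact_rightComp (P : D) {A : Triangle D} (hA : A ∈ distTriang D) :
    Function.Exact (Linear.rightComp R P A.mor₁) (Linear.rightComp R P A.mor₂) := by
  intro x
  constructor
  · intro hx
    obtain ⟨y, hy⟩ := A.coyoneda_exact₂ hA x hx
    exact ⟨y, hy.symm⟩
  · rintro ⟨y, rfl⟩
    simp [comp_distTriang_mor_zero₁₂ _ hA]

variable (R) in
lemma exact_leftComp (X : D) {A : Triangle D} (hA : A ∈ distTriang D) :
    Function.Exact (Linear.leftComp R X A.mor₃) (Linear.leftComp R X A.mor₂) := by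
  intro x
  constructor
  · intro hx
    obtain ⟨y, hy⟩ := A.yoneda_exact₃ hA x hx
    exact ⟨y, hy.symm⟩
  · rintro ⟨y, rfl⟩
    simp [comp_distTriang_mor_zero₂₃_assoc _ hA]

variable (R) in
lemma isShiftSubadditive_homWeight (t : ℝ) (P : D) :
    IsShiftSubadditive t (homWeight R t P) where
  le_add A hA := by
    rw [homWeight, homWeight, homWeight, ← ENNReal.tsum_add]
    refine ENNReal.tsum_le_tsum fun i => ?_
    rw [← mul_add, ← ENat.toENNReal_add]
    gcongr
    exact length_le_add_of_exact _ _ (exact_rightComp R P (Triangle.shift_distinguished _ hA i))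
  shift_le X n := by
    rw [homWeight, homWeight, ← ENNReal.tsum_mul_left,
      ← (Equiv.addLeft n).tsum_eq (fun i : ℤ => ENNReal.ofReal (Real.exp (n * t)) * _)]
    refine ENNReal.tsum_le_tsum fun i => ?_
    rw [← mul_assoc, ← ENNReal.ofReal_mul (by positivity), ← Real.exp_add,
      (homCongrRight (R := R) P (shiftAdd X n i).symm).length_eq]
    refine mul_le_mul_left (le_of_eq ?_) _
    simp only [Equiv.coe_addLeft]
    push_cast
    ring_nf
  retract_le {X Y} r := by
    refine ENNReal.tsum_le_tsum fun i => mul_le_mul_right (ENat.toENNReal_le.2 ?_) _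
    refine Module.length_le_of_injective (Linear.rightComp R P (r.i⟦i⟧')) fun f g hfg => ?_
    have h : (f ≫ r.i⟦i⟧') ≫ r.r⟦i⟧' = (g ≫ r.i⟦i⟧') ≫ r.r⟦i⟧' := congrArg (· ≫ r.r⟦i⟧') hfg
    simpa [← Functor.map_comp] using h

lemma IsHomNoetherian.ext₂ {P : D} {A : Triangle D} (hA : A ∈ distTriang D) (h₁ : IsHomNoetherian R P A.obj₁)
    (h₃ : IsHomNoetherian R P A.obj₃) : IsHomNoetherian R P A.obj₂ where
  isNoetherian i := by
    have hex := exact_rightComp R P (Triangle.shift_distinguished _ hA i)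
    let f : (P ⟶ A.obj₁⟦i⟧) →ₗ[R] (P ⟶ A.obj₂⟦i⟧) :=
      Linear.rightComp R P ((Triangle.shiftFunctor D i).obj A).mor₁
    let g : (P ⟶ A.obj₂⟦i⟧) →ₗ[R] (P ⟶ A.obj₃⟦i⟧) :=
      Linear.rightComp R P ((Triangle.shiftFunctor D i).obj A).mor₂
    have := h₁.isNoetherian i
    have := h₃.isNoetherian i
    exact isNoetherian_of_range_eq_ker f g (LinearMap.exact_iff.1 hex).symm
  finite := (h₁.finite.union h₃.finite).subset fun i hi => by
    by_contra hcon
    simp only [Set.mem_union, Set.mem_ofPred_eq, not_or, not_not] at hcon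
    have := hcon.1
    have := hcon.2
    exact hi (subsingleton_of_exact (M := P ⟶ A.obj₁⟦i⟧) (Q := P ⟶ A.obj₃⟦i⟧)
      (exact_rightComp R P (Triangle.shift_distinguished _ hA i)))

section LinearShift

variable [∀ n : ℤ, (shiftFunctor D n).Linear R]

/-- The shift functor as a linear equivalence on morphisms. -/
noncomputable def shiftHomEquiv (P X : D) (n : ℤ) : (P ⟶ X) ≃ₗ[R] (P⟦n⟧ ⟶ X⟦n⟧) :=
  .ofBijective ((shiftFunctor D n).mapLinearMap R) ⟨(shiftFunctor D n).map_injective, (shiftFunctor D n).map_surjective⟩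

/-- The linear equivalence between `Hom(P, X⟦i⟧)` and `Hom(P⟦1⟧, X⟦i + 1⟧)`. -/
noncomputable def shiftOneHomEquiv (P X : D) (i : ℤ) : (P ⟶ X⟦i⟧) ≃ₗ[R] (P⟦(1 : ℤ)⟧ ⟶ X⟦i + 1⟧) :=
  (shiftHomEquiv P (X⟦i⟧) 1).trans (homCongrRight _ (shiftAdd X i 1).symm)

lemma IsHomNoetherian.of_distTriang {A : Triangle D} (hA : A ∈ distTriang D) {X : D}
    (h₁ : IsHomNoetherian R A.obj₁ X) (h₂ : IsHomNoetherian R A.obj₂ X) :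
    IsHomNoetherian R A.obj₃ X where
  isNoetherian i := by
    have := h₂.isNoetherian i
    have := h₁.isNoetherian (i - 1)
    have : IsNoetherian R (A.obj₁⟦(1 : ℤ)⟧ ⟶ X⟦i⟧) := by
      have := isNoetherian_of_linearEquiv (shiftOneHomEquiv (R := R) A.obj₁ X (i - 1))
      rwa [sub_add_cancel] at this
    exact isNoetherian_of_range_eq_ker _ _ (LinearMap.exact_iff.1 (exact_leftComp R (X⟦i⟧) hA)).symm
  finite := ((h₁.finite.image (· + 1)).union h₂.finite).subset fun i hi => by
    by_contra hcon
    simp only [Set.mem_union, Set.mem_image, Set.mem_ofPred_eq, not_or, not_not] at hcon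
    have := hcon.2
    have h1 : Subsingleton (A.obj₁ ⟶ X⟦i - 1⟧) := by
      by_contra h
      exact hcon.1 ⟨i - 1, h, by ring⟩
    have : Subsingleton (A.obj₁⟦(1 : ℤ)⟧ ⟶ X⟦i⟧) := by
      have := (shiftOneHomEquiv (R := R) A.obj₁ X (i - 1)).symm.subsingleton
      rwa [sub_add_cancel] at this
    exact hi (subsingleton_of_exact (exact_leftComp R (X⟦i⟧) hA))

/-- Nilpotence of the action of `y` passes to cones. -/
lemma pow_add_smul_id_eq_zero {A : Triangle D} (hA : A ∈ distTriang D) {y : R} {a b : ℕ}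
    (h₁ : y ^ a • 𝟙 A.obj₁ = 0) (h₂ : y ^ b • 𝟙 A.obj₂ = 0) : y ^ (a + b) • 𝟙 A.obj₃ = 0 := by
  obtain ⟨g, hg⟩ := A.yoneda_exact₃ hA (y ^ b • 𝟙 A.obj₃) (by
    rw [Linear.comp_smul, Category.comp_id, ← Category.id_comp A.mor₂, ← Linear.smul_comp, h₂,
      zero_comp])
  rw [pow_add, mul_smul, hg, ← Linear.smul_comp, ← Category.comp_id A.mor₃, ← Linear.comp_smul,
    ← CategoryTheory.Functor.map_id, ← Functor.map_smul, h₁, Functor.map_zero, comp_zero, zero_comp]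

/-- On the cone of `x • 𝟙`, the square of `x` acts as zero; in general `x` itself does not. -/
lemma sq_smul_id_cone_eq_zero {P : D} {x : R} {C : D} {g : P ⟶ C} {h : C ⟶ P⟦(1 : ℤ)⟧}
    (hA : Triangle.mk (x • 𝟙 P) g h ∈ distTriang D) : x ^ 2 • 𝟙 C = 0 := by
  have h12 : (x • 𝟙 P) ≫ g = 0 := comp_distTriang_mor_zero₁₂ _ hA
  have h31 : h ≫ (x • 𝟙 P)⟦(1 : ℤ)⟧' = 0 := comp_distTriang_mor_zero₃₁ _ hA
  rw [Linear.smul_comp, Category.id_comp] at h12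
  rw [Functor.map_smul, CategoryTheory.Functor.map_id, Linear.comp_smul, Category.comp_id] at h31
  obtain ⟨k, hk⟩ : ∃ k : P⟦(1 : ℤ)⟧ ⟶ C, x • 𝟙 C = h ≫ k :=
    Triangle.yoneda_exact₃ _ hA (x • 𝟙 C) (by
      change g ≫ (x • 𝟙 C) = 0
      rw [Linear.comp_smul, Category.comp_id, h12])
  rw [pow_two, mul_smul, hk, ← Linear.smul_comp, h31, zero_comp]

end LinearShift

end Pretriangulated

end HomLength

/-! ### Koszul objects -/

section Koszul

variable {R : Type*} [CommRing R] {D : Type u} [Category.{v} D] [Preadditive D] [Linear R D]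
  [HasShift D ℤ] [HasZeroObject D] [∀ n : ℤ, (shiftFunctor D n).Additive] [Pretriangulated D]
  [∀ n : ℤ, (shiftFunctor D n).Linear R]

/-- The iterated cone `P` of the endomorphisms `x • 𝟙`, for `x` in a list `l`, starting from an
object `P₀` (a Koszul object of `P₀`). Every `x ∈ l` acts nilpotently on `P`, and the top degree of
`Hom(P, Y⟦•⟧)` is `Hom(P₀, Y) / (l)`, provided that `Hom(P₀, Y⟦i⟧)` vanishes for `i > 0`. -/
theorem exists_koszul (P₀ : D) (l : List R) : ∃ P : D,
    (∀ X : D, IsHomNoetherian R P₀ X → IsHomNoetherian R P X) ∧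
    (∀ x ∈ l, ∃ n : ℕ, x ^ n • 𝟙 P = 0) ∧
    ∀ Y : D, (∀ i : ℤ, 0 < i → Subsingleton (P₀ ⟶ Y⟦i⟧)) →
      (∀ i : ℤ, (l.length : ℤ) < i → Subsingleton (P ⟶ Y⟦i⟧)) ∧
      ∃ g : (P₀ ⟶ Y) →ₗ[R] (P ⟶ Y⟦(l.length : ℤ)⟧), Function.Surjective g ∧
        LinearMap.ker g ≤ Ideal.ofList l • ⊤ := by
  induction l with
  | nil =>
    refine ⟨P₀, fun X h => h, by simp, fun Y hY => ⟨fun i hi => hY i (by simpa using hi), ?_⟩⟩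
    let e : (P₀ ⟶ Y) ≃ₗ[R] (P₀ ⟶ Y⟦(([] : List R).length : ℤ)⟧) :=
      homCongrRight P₀ ((shiftFunctorZero D ℤ).symm.app Y)
    exact ⟨e.toLinearMap, e.surjective, by simp⟩
  | cons x l ih =>
    obtain ⟨P, hP, hnil, htop⟩ := ih
    obtain ⟨C, a, b, hA⟩ := distinguished_cocone_triangle (x • 𝟙 P)
    refine ⟨C, fun X hX => .of_distTriang hA (hP X hX) (hP X hX), ?_, fun Y hY => ?_⟩
    · intro y hy
      rcases List.mem_cons.1 hy with rfl | hy
      · exact ⟨2, sq_smul_id_cone_eq_zero hA⟩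
      · obtain ⟨n, hn⟩ := hnil y hy
        exact ⟨n + n, pow_add_smul_id_eq_zero hA hn hn⟩
    · obtain ⟨hvan, g, hg, hker⟩ := htop Y hY
      simp only [List.length_cons, Nat.cast_succ]
      constructor
      · intro i hi
        have h1 : Subsingleton (P ⟶ Y⟦i⟧) := hvan i (by lia)
        have h2 : Subsingleton (P⟦(1 : ℤ)⟧ ⟶ Y⟦i⟧) := by
          have := hvan (i - 1) (by lia)
          have := (shiftOneHomEquiv (R := R) P Y (i - 1)).symm.subsingleton
          rwa [sub_add_cancel] at this
        exact @subsingleton_of_exact R _ _ _ _ _ _ _ _ _ _ _ _ (exact_leftComp R (Y⟦i⟧) hA) h2 h1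
      · let e := shiftOneHomEquiv (R := R) P Y l.length
        let δ : (P⟦(1 : ℤ)⟧ ⟶ Y⟦(l.length : ℤ) + 1⟧) →ₗ[R] (C ⟶ Y⟦(l.length : ℤ) + 1⟧) :=
          Linear.leftComp R _ b
        refine ⟨δ ∘ₗ e.toLinearMap ∘ₗ g, ?_, ?_⟩
        · have hδ : Function.Surjective δ := fun f => by
            have := hvan (l.length + 1) (by lia)
            obtain ⟨k, hk⟩ := Triangle.yoneda_exact₃ _ hA f
              (@Subsingleton.elim (P ⟶ Y⟦(l.length : ℤ) + 1⟧) _ _ _)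
            exact ⟨k, hk.symm⟩
          exact hδ.comp (e.surjective.comp hg)
        · intro n hn
          obtain ⟨k, hk⟩ : ∃ k : P⟦(1 : ℤ)⟧ ⟶ Y⟦(l.length : ℤ) + 1⟧,
              e (g n) = (-(x • 𝟙 P)⟦(1 : ℤ)⟧') ≫ k :=
            Triangle.yoneda_exact₃ _ (rot_of_distTriang _ hA) (e (g n)) hn
          -- By exactness, the kernel of the connecting map consists of multiples of `x`.
          obtain ⟨m, hm⟩ := hg (e.symm (-k))
          have h1 : g n = x • g m := by
            apply e.injective
            rw [hk, map_smul, hm, LinearEquiv.apply_symm_apply, Functor.map_smul,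
              CategoryTheory.Functor.map_id]
            simp
          rw [Ideal.ofList_cons, ← add_sub_cancel (x • m) n]
          refine add_mem (Submodule.smul_mem_smul (Ideal.mem_sup_left
            (Ideal.mem_span_singleton_self x)) trivial) (Submodule.smul_mono_left le_sup_right
            (hker ?_))
          rw [LinearMap.mem_ker, map_sub, map_smul, h1, sub_self]

end Koszul

/-! ### Morphisms from the ring in the bounded derived category -/

section BoundedDerived

/-- The bounded derived category is generated by complexes concentrated in one degree, under
extensions and isomorphisms. -/
lemma bounded_induction {C : Type u} [Category.{v} C] [Abelian C] [HasDerivedCategory.{w} C]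
    (P : ObjectProperty (DerivedCategory C)) [P.IsClosedUnderIsomorphisms]
    [P.IsTriangulatedClosed₂]
    (hP : ∀ (n : ℤ) (A : C), P ((DerivedCategory.singleFunctor C n).obj A))
    {X : DerivedCategory C} (hX : DerivedCategory.TStructure.t.bounded X) : P X := by
  obtain ⟨⟨a, ha⟩, ⟨b, hb⟩⟩ := hX
  obtain ⟨n, hn⟩ : ∃ n : ℕ, b ≤ a + n := ⟨(b - a).toNat, by lia⟩
  have hb' : X.IsLE (a + n) := DerivedCategory.TStructure.t.isLE_of_le X b (a + n)
  clear hb hn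
  induction n generalizing a X with
  | zero =>
    rw [Nat.cast_zero, add_zero] at hb'
    obtain ⟨A, ⟨e⟩⟩ := X.exists_iso_singleFunctor_obj_of_isGE_of_isLE a
    exact P.prop_of_iso e.symm (hP a A)
  | succ n ih =>
    let t := DerivedCategory.TStructure.t (C := C)
    refine P.ext_of_isTriangulatedClosed₂ _ (t.triangleLTGE_distinguished (a + 1) X) ?_ ?_
    · have h1 : t.IsGE ((t.truncLT (a + 1)).obj X) a := inferInstance
      have h2 : t.IsLE ((t.truncLT (a + 1)).obj X) a := inferInstance
      obtain ⟨A, ⟨e⟩⟩ :=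
        ((t.truncLT (a + 1)).obj X).exists_iso_singleFunctor_obj_of_isGE_of_isLE a
      exact P.prop_of_iso e.symm (hP a A)
    · have h1 : t.IsGE ((t.truncGE (a + 1)).obj X) (a + 1) := inferInstance
      have h2 : t.IsLE ((t.truncGE (a + 1)).obj X) (a + 1 + n) := by
        have : t.IsLE X (a + 1 + n) := by convert! hb' using 1; push_cast; ring
        infer_instance
      exact ih (a + 1) h1 h2

variable (R : Type u) [CommRing R] [IsNoetherianRing R]

instance : Projective (FGModuleCat.of R R) where
  factors {E X} f e he := by
    have h1 : Epi ((forget₂ (FGModuleCat.{u} R) (ModuleCat.{u} R)).map e) := inferInstance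
    have h2 : Projective (ModuleCat.of R R) :=
      (IsProjective.iff_projective R).1 inferInstance
    obtain ⟨g, hg⟩ := h2.factors ((forget₂ (FGModuleCat.{u} R) (ModuleCat.{u} R)).map f)
      ((forget₂ (FGModuleCat.{u} R) (ModuleCat.{u} R)).map e)
    exact ⟨ObjectProperty.homMk g, ObjectProperty.hom_ext _ hg⟩

/-- Morphisms out of the free module of rank one. -/
noncomputable def fgHomEquiv (N : FGModuleCat.{u} R) : (FGModuleCat.of R R ⟶ N) ≃ₗ[R] N where
  toFun f := f.hom.hom 1
  invFun n := ObjectProperty.homMk (ModuleCat.ofHom (LinearMap.toSpanSingleton R N n))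
  map_add' _ _ := rfl
  map_smul' _ _ := rfl
  left_inv f := by
    ext
    simp
  right_inv n := by simp

variable [HasDerivedCategory.{w} (FGModuleCat.{u} R)]

open DerivedCategory

/-- Vanishing of morphisms out of `R` into negative degrees uses that `R` is projective. -/
lemma subsingleton_hom_of_isLE {X : DerivedCategory (FGModuleCat.{u} R)} (n : ℤ) (hn : n < 0)
    [X.IsLE n] : Subsingleton ((singleFunctor _ 0).obj (FGModuleCat.of R R) ⟶ X) := by
  refine subsingleton_of_forall_eq 0 fun f => ?_
  obtain ⟨K, hK, ⟨e⟩⟩ := X.exists_iso_Q_obj_of_isLE n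
  rw [← cancel_mono e.hom, zero_comp]
  exact from_singleFunctor_obj_eq_zero_of_projective (i := 0) (L := K) (f ≫ e.hom) n hn

lemma subsingleton_hom_of_isGE {X : DerivedCategory (FGModuleCat.{u} R)} (n : ℤ) (hn : 0 < n)
    [X.IsGE n] : Subsingleton ((singleFunctor _ 0).obj (FGModuleCat.of R R) ⟶ X) :=
  subsingleton_of_forall_eq 0 fun f => TStructure.t.zero f 0 n

/-- Morphisms in the derived category from the free module of rank one to a module. -/
noncomputable def singleHomEquiv (N : FGModuleCat.{u} R) :
    ((singleFunctor _ 0).obj (FGModuleCat.of R R) ⟶ (singleFunctor _ 0).obj N) ≃ₗ[R] N :=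
  (LinearEquiv.ofBijective ((singleFunctor _ 0).mapLinearMap R)
    ⟨(singleFunctor (FGModuleCat.{u} R) 0).map_injective,
      (singleFunctor (FGModuleCat.{u} R) 0).map_surjective⟩).symm.trans (fgHomEquiv R N)

lemma subsingleton_hom_single_shift (N : FGModuleCat.{u} R) (i : ℤ) (hi : i ≠ 0) :
    Subsingleton ((singleFunctor _ 0).obj (FGModuleCat.of R R) ⟶
      ((singleFunctor _ 0).obj N)⟦i⟧) := by
  have h1 := TStructure.t.isLE_shift ((singleFunctor _ 0).obj N) 0 i (-i)
  have h2 := TStructure.t.isGE_shift ((singleFunctor _ 0).obj N) 0 i (-i)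
  rcases hi.lt_or_gt with hi | hi
  · exact subsingleton_hom_of_isGE R (-i) (by lia)
  · exact subsingleton_hom_of_isLE R (-i) (by lia)

lemma isHomNoetherian_single (N : FGModuleCat.{u} R) :
    IsHomNoetherian R ((singleFunctor _ 0).obj (FGModuleCat.of R R))
      ((singleFunctor _ 0).obj N) where
  isNoetherian i := by
    by_cases hi : i = 0
    · subst hi
      have : IsNoetherian R N := isNoetherian_of_isNoetherianRing_of_finite R N
      exact isNoetherian_of_linearEquiv ((singleHomEquiv R N).symm.trans
        (homCongrRight _ ((shiftFunctorZero _ ℤ).symm.app _)))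
    · have := subsingleton_hom_single_shift R N i hi
      infer_instance
  finite := (Set.finite_singleton (0 : ℤ)).subset fun i hi => by
    by_contra h
    exact hi (subsingleton_hom_single_shift R N i h)

lemma isHomNoetherian_of_bounded {X : DerivedCategory (FGModuleCat.{u} R)}
    (hX : TStructure.t.bounded X) :
    IsHomNoetherian R ((singleFunctor _ 0).obj (FGModuleCat.of R R)) X := by
  let P : ObjectProperty (DerivedCategory (FGModuleCat.{u} R)) := fun X =>
    IsHomNoetherian R ((singleFunctor _ 0).obj (FGModuleCat.of R R)) X
  have : P.IsClosedUnderIsomorphisms := ⟨fun e h => h.of_iso e⟩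
  have : P.IsTriangulatedClosed₂ := .mk' fun A hA h₁ h₃ => .ext₂ hA h₁ h₃
  refine bounded_induction P (fun n N => ?_) hX
  have e : ((singleFunctor _ 0).obj N)⟦-n⟧ ≅ (singleFunctor _ n).obj N :=
    ((singleFunctors _).shiftIso (-n) n 0 (by lia)).app N
  exact ((isHomNoetherian_single R N).shift (-n)).of_iso e

end BoundedDerived

/-! ### Lengths, restriction of scalars and local entropy -/

section Length

open TensorProduct

lemma length_ne_top_of_le_radical_annihilator {R M : Type*} [CommRing R] [IsNoetherianRing R]
    [IsLocalRing R] [AddCommGroup M] [Module R M] [IsNoetherian R M] {I : Ideal R}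
    (hI : I.radical = maximalIdeal R) (hann : I ≤ (Module.annihilator R M).radical) :
    Module.length R M ≠ ⊤ := by
  rcases subsingleton_or_nontrivial M with hM | hM
  · simp [Module.length_eq_zero]
  have hJ : Module.annihilator R M ≠ ⊤ := fun h => not_subsingleton M (Module.annihilator_eq_top_iff.1 h)
  have hm : maximalIdeal R ≤ (Module.annihilator R M).radical := hI ▸ Ideal.radical_le_radical_iff.2 hann
  have : IsArtinianRing (R ⧸ Module.annihilator R M) :=
    quotient_artinian_of_mem_minimalPrimes_of_isLocalRing _
      ⟨⟨inferInstance, le_maximalIdeal hJ⟩, fun p hp _ => hm.trans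
        ((Ideal.IsPrime.radical_le_iff hp.1).2 hp.2)⟩
  let _ : Module (R ⧸ Module.annihilator R M) M := Module.quotientAnnihilator
  have : IsScalarTower R (R ⧸ Module.annihilator R M) M := ⟨fun a b m => by
    obtain ⟨b, rfl⟩ := Ideal.Quotient.mk_surjective b
    exact mul_smul a b m⟩
  have : IsNoetherian (R ⧸ Module.annihilator R M) M := isNoetherian_of_tower R inferInstance
  have hfl : IsFiniteLength (R ⧸ Module.annihilator R M) M := ((IsArtinianRing.tfae (R ⧸ Module.annihilator R M) M).out 1 3).1 this
  rw [Module.length_eq_of_surjective (S := R) (R := R ⧸ Module.annihilator R M) Ideal.Quotient.mk_surjective]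
  exact Module.length_ne_top_iff.2 hfl

/-- Base change along a ring homomorphism `A → B` multiplies lengths at most by the length of the
closed fibre. -/
lemma length_baseChange_le {A B : Type*} [CommRing A] [CommRing B] [IsLocalRing A] [Algebra A B]
    {M : Type*} [AddCommGroup M] [Module A M] (hM : IsFiniteLength A M) :
    Module.length B (B ⊗[A] M) ≤
      Module.length A M * Module.length B (B ⧸ (maximalIdeal A).map (algebraMap A B)) := by
  induction hM with
  | of_subsingleton => simp [Module.length_eq_zero]
  | @of_simple_quotient M _ _ N hs hN ih =>
    obtain ⟨m, hm, ⟨e⟩⟩ := isSimpleModule_iff_quot_maximal.mp hs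
    obtain rfl := eq_maximalIdeal hm
    have hlen : Module.length A M = Module.length A N + 1 := by
      rw [Module.length_eq_add_of_exact N.subtype N.mkQ N.injective_subtype N.mkQ_surjective
        (LinearMap.exact_subtype_mkQ N), Module.length_eq_one A (M ⧸ N)]
    have hex : Function.Exact (AlgebraTensorModule.lTensor B B N.subtype)
        (AlgebraTensorModule.lTensor B B N.mkQ) :=
      lTensor_exact B (LinearMap.exact_subtype_mkQ N) N.mkQ_surjective
    refine (length_le_add_of_exact _ _ hex).trans ?_
    rw [hlen, add_mul, one_mul]
    refine add_le_add ih (le_of_eq ?_)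
    rw [(AlgebraTensorModule.congr (LinearEquiv.refl B B) e).length_eq,
      (Algebra.TensorProduct.quotIdealMapEquivTensorQuot B (maximalIdeal A)).toLinearEquiv.length_eq]

lemma length_quotient_map_le {A B : Type*} [CommRing A] [CommRing B] [IsLocalRing A]
    (ψ : A →+* B) {I : Ideal A} (hI : Module.length A (A ⧸ I) ≠ ⊤) :
    Module.length B (B ⧸ I.map ψ) ≤
      Module.length A (A ⧸ I) * Module.length B (B ⧸ (maximalIdeal A).map ψ) := by
  let _ := ψ.toAlgebra
  have := length_baseChange_le (B := B) (Module.length_ne_top_iff.1 hI)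
  rwa [← (Algebra.TensorProduct.quotIdealMapEquivTensorQuot B I).toLinearEquiv.length_eq] at this

lemma length_restrictScalars_quotient {A B M : Type*} [CommRing A] [CommRing B] [IsLocalRing A]
    [IsLocalRing B] [Algebra A B] [IsLocalHom (algebraMap A B)] [AddCommGroup M] [Module A M]
    [Module B M] [IsScalarTower A B M] (I : Ideal A) :
    Module.length A (M ⧸ (I • ⊤ : Submodule A M)) =
      Module.length B (M ⧸ (I.map (algebraMap A B) • ⊤ : Submodule B M)) *
        Module.length (ResidueField A) (ResidueField B) := by
  rw [← IsLocalRing.length_restrictScalars A B]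
  have h : (I • ⊤ : Submodule A M) =
      (I.map (algebraMap A B) • ⊤ : Submodule B M).restrictScalars A := by
    rw [Ideal.smul_restrictScalars, Submodule.restrictScalars_top]
  rw [h]
  exact (Submodule.Quotient.restrictScalarsEquiv A _).length_eq

end Length

section Pushforward

variable {R : Type u} [CommRing R] [IsLocalRing R]

/-- The canonical module structure on the residue field of an extension is restriction of scalars
along the induced homomorphism of residue fields. -/
lemma residueField_module_eq (A B : Type*) [CommRing A] [CommRing B] [IsLocalRing A]
    [IsLocalRing B] [Algebra A B] [IsLocalHom (algebraMap A B)] :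
    (inferInstance : Module (ResidueField A) (ResidueField B)) =
      Module.compHom (ResidueField B) (ResidueField.map (algebraMap A B)) :=
  Module.ext' _ _ fun x y => Algebra.smul_def x y

lemma length_fgPushforward_quotient {A B : Type u} [CommRing A] [CommRing B] [IsLocalRing A]
    [IsLocalRing B] (f : A →+* B) [IsLocalHom f] (hf : f.Finite) (M : FGModuleCat.{u} B)
    (I : Ideal A) :
    Module.length A ((fgPushforward f hf).obj M ⧸
        (I • ⊤ : Submodule A ((fgPushforward f hf).obj M))) =
      Module.length B (M ⧸ (I.map f • ⊤ : Submodule B M)) *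
        @Module.length (ResidueField A) (ResidueField B) _ _
          (Module.compHom (ResidueField B) (ResidueField.map f)) := by
  let _ := f.toAlgebra
  have : IsLocalHom (algebraMap A B) := ‹IsLocalHom f›
  let _ : Module A M := Module.compHom M f
  have : IsScalarTower A B M := ⟨fun r s m => by
      change (f r * s) • m = f r • s • m
      rw [mul_smul]⟩
  have h := length_restrictScalars_quotient (A := A) (B := B) (M := M) I
  rw [show (ResidueField.instModule : Module (ResidueField A) (ResidueField B)) = _ from
    residueField_module_eq A B] at h
  exact h

lemma length_residueField_eq {A B : Type u} [CommRing A] [CommRing B] [IsLocalRing A]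
    [IsLocalRing B] (f : A →+* B) [IsLocalHom f] (hf : f.Finite) :
    @Module.length (ResidueField A) (ResidueField B) _ _
      (Module.compHom (ResidueField B) (ResidueField.map f)) =
    @Module.finrank (ResidueField A) (ResidueField B) _ _
      (Module.compHom (ResidueField B) (ResidueField.map f)) := by
  let _ := f.toAlgebra
  have : IsLocalHom (algebraMap A B) := ‹IsLocalHom f›
  have : Module.Finite A B := hf
  have h := Module.length_eq_finrank (ResidueField A) (ResidueField B)
  rw [show (ResidueField.instModule : Module (ResidueField A) (ResidueField B)) = _ from
    residueField_module_eq A B] at h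
  exact h

lemma residueDegree_pos (φ : R →+* R) [IsLocalHom φ] (hf : φ.Finite) : 0 < residueDegree φ := by
  have h := length_residueField_eq φ hf
  have h2 : 0 < ((residueDegree φ : ℕ) : ℕ∞) := by
    rw [residueDegree, ← h]
    exact @Module.length_pos _ _ _ _ (Module.compHom _ (ResidueField.map φ)) _
  exact_mod_cast h2

/-- The length of `N ⧸ I N` for an iterated pushforward `N = φ_*^e M`: restriction of scalars along
`φ` multiplies lengths by `[φ_*k : k]` and turns `I` into its extension `φ(I)R`. -/
lemma length_iterate_fgPushforward_quotient (φ : R →+* R) [IsLocalHom φ] (hf : φ.Finite) (e : ℕ)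
    (M : FGModuleCat.{u} R) (I : Ideal R) :
    Module.length R ((fgPushforward φ hf).obj^[e] M ⧸
        (I • ⊤ : Submodule R ((fgPushforward φ hf).obj^[e] M))) =
      Module.length R (M ⧸ (I.map (φ ^ e) • ⊤ : Submodule R M)) * (residueDegree φ : ℕ∞) ^ e := by
  induction e generalizing M with
  | zero =>
    have h : I.map (φ ^ 0) = I := Ideal.map_id I
    rw [h, pow_zero, mul_one]
    rfl
  | succ e ih =>
    rw [Function.iterate_succ_apply, ih, length_fgPushforward_quotient, length_residueField_eq φ hf,
      Ideal.map_map, pow_succ' φ, pow_succ' (residueDegree φ : ℕ∞), ← mul_assoc]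
    rfl

end Pushforward

section LocalEntropy

variable {R : Type u} [CommRing R] [IsLocalRing R]

lemma map_pow_maximalIdeal_le (φ : R →+* R) [IsLocalHom φ] (e : ℕ) :
    (maximalIdeal R).map (φ ^ e) ≤ maximalIdeal R := by
  induction e with
  | zero => exact (Ideal.map_id _).le
  | succ e ih =>
    rw [pow_succ', RingHom.mul_def, ← Ideal.map_map]
    exact (Ideal.map_mono ih).trans (le_maximalIdeal (map_maximalIdeal_lt_top φ).ne)

lemma exists_pow_le_map_pow [IsNoetherianRing R] {φ : R →+* R} (hφ : IsOfFiniteLength φ) (e : ℕ) :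
    ∃ n : ℕ, maximalIdeal R ^ n ≤ (maximalIdeal R).map (φ ^ e) := by
  induction e with
  | zero => exact ⟨1, by rw [pow_one]; exact (Ideal.map_id _).ge⟩
  | succ e ih =>
    obtain ⟨n, hn⟩ := ih
    obtain ⟨m, hm⟩ := Ideal.exists_pow_le_of_le_radical_of_fg hφ.2.ge
      (IsNoetherian.noetherian (maximalIdeal R))
    refine ⟨m * n, ?_⟩
    rw [pow_succ', RingHom.mul_def, ← Ideal.map_map, pow_mul]
    refine (Ideal.pow_right_mono hm n).trans ?_
    rw [← Ideal.map_pow]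
    exact Ideal.map_mono hn

lemma length_quotient_ne_top [IsNoetherianRing R] {I : Ideal R} {n : ℕ}
    (hn : maximalIdeal R ^ n ≤ I) : Module.length R (R ⧸ I) ≠ ⊤ := by
  refine length_ne_top_of_le_radical_annihilator (I := maximalIdeal R)
    (maximalIdeal.isMaximal R).isPrime.radical ?_
  rw [Ideal.annihilator_quotient]
  exact fun x hx => ⟨n, hn (Ideal.pow_mem_pow hx n)⟩

lemma length_quotient_map_pow_ne_top [IsNoetherianRing R] {φ : R →+* R} (hφ : IsOfFiniteLength φ)
    (e : ℕ) : Module.length R (R ⧸ (maximalIdeal R).map (φ ^ e)) ≠ ⊤ := by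
  obtain ⟨n, hn⟩ := exists_pow_le_map_pow hφ e
  exact length_quotient_ne_top hn

lemma one_le_length_quotient_map_pow (φ : R →+* R) [IsLocalHom φ] (e : ℕ) :
    1 ≤ Module.length R (R ⧸ (maximalIdeal R).map (φ ^ e)) := by
  have : Nontrivial (R ⧸ (maximalIdeal R).map (φ ^ e)) := Ideal.Quotient.nontrivial_iff.2
    ((map_pow_maximalIdeal_le φ e).trans_lt (maximalIdeal.isMaximal R).ne_top.lt_top).ne
  exact Order.one_le_iff_pos.2 Module.length_pos

lemma length_quotient_map_pow_add_le [IsNoetherianRing R] {φ : R →+* R} (hφ : IsOfFiniteLength φ)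
    (e f : ℕ) : Module.length R (R ⧸ (maximalIdeal R).map (φ ^ (e + f))) ≤
      Module.length R (R ⧸ (maximalIdeal R).map (φ ^ e)) *
        Module.length R (R ⧸ (maximalIdeal R).map (φ ^ f)) := by
  rw [add_comm, pow_add, RingHom.mul_def, ← Ideal.map_map]
  exact length_quotient_map_le (φ ^ f) (length_quotient_map_pow_ne_top hφ e)

theorem tendsto_localEntropySeq [IsNoetherianRing R] {φ : R →+* R} [IsLocalHom φ]
    (hφ : IsOfFiniteLength φ) : Tendsto (localEntropySeq φ) atTop (𝓝 (localEntropy φ)) := by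
  let a : ℕ → ℝ≥0∞ := fun e =>
    ((Module.length R (R ⧸ (maximalIdeal R).map (φ ^ e)) : ℕ∞) : ℝ≥0∞)
  have hfin : ∀ e, a e ≠ ∞ := fun e => by simpa [a] using length_quotient_map_pow_ne_top hφ e
  have hmul : ∀ e f, a (e + f) ≤ a e * a f := fun e f => by
    rw [← ENat.toENNReal_mul]
    exact ENat.toENNReal_le.2 (length_quotient_map_pow_add_le hφ e f)
  have hone : ∀ e, 1 ≤ a e := fun e => by
    rw [← ENat.toENNReal_one]
    exact ENat.toENNReal_le.2 (one_le_length_quotient_map_pow φ e)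
  obtain ⟨h, hh⟩ := exists_tendsto_log_toReal_div hfin hmul one_ne_zero hone
  have heq : localEntropySeq φ = fun e : ℕ => Real.log (a e).toReal / e := by
    funext e
    obtain ⟨n, hn⟩ := ENat.ne_top_iff_exists.1 (length_quotient_map_pow_ne_top hφ e)
    simp [localEntropySeq, a, ← hn]
  rw [← heq] at hh
  rwa [localEntropy, hh.limUnder_eq]

end LocalEntropy

/-! ### Growth of the Hilbert–Samuel function -/

section HilbertSamuel

lemma add_pow_succ_le_pow_add (m k d : ℕ) :
    (m + k) ^ (d + 1) ≤ m ^ (d + 1) + (d + 1) * k * (m + k) ^ d := by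
  induction d with
  | zero => simp
  | succ d ih =>
    calc (m + k) ^ (d + 1 + 1) = (m + k) ^ (d + 1) * (m + k) := pow_succ _ _
      _ ≤ (m ^ (d + 1) + (d + 1) * k * (m + k) ^ d) * (m + k) := by gcongr
      _ = m ^ (d + 1 + 1) + k * m ^ (d + 1) + (d + 1) * k * (m + k) ^ (d + 1) := by ring
      _ ≤ m ^ (d + 1 + 1) + k * (m + k) ^ (d + 1) + (d + 1) * k * (m + k) ^ (d + 1) := by
        gcongr; omega
      _ = _ := by ring

variable {R : Type*} [CommRing R]

/-- Multiplication by `x` identifies `R ⧸ (J : x)` with a submodule of `R ⧸ J`, whose cokernel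
`R ⧸ (J + (x))` surjects onto `R ⧸ Q`. -/
lemma length_add_length_le {Q J J' : Ideal R} {x : R} (hJ : J ≤ Q) (hx : x ∈ Q)
    (hJ' : ∀ r, x * r ∈ J → r ∈ J') :
    Module.length R (R ⧸ J') + Module.length R (R ⧸ Q) ≤ Module.length R (R ⧸ J) := by
  let f : R →ₗ[R] R ⧸ J := LinearMap.toSpanSingleton R _ (Ideal.Quotient.mk J x)
  have hf : ∀ r, f r = Ideal.Quotient.mk J (x * r) := fun r => by
    rw [mul_comm, map_mul]; rfl
  rw [Module.length_eq_add_of_exact (LinearMap.range f).subtype (LinearMap.range f).mkQ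
    (LinearMap.range f).injective_subtype (LinearMap.range f).mkQ_surjective
    (LinearMap.exact_subtype_mkQ _)]
  refine add_le_add ?_ ?_
  · rw [← f.quotKerEquivRange.length_eq]
    refine Module.length_le_of_surjective (Submodule.factor ?_) (Submodule.factor_surjective _)
    intro r hr
    rw [LinearMap.mem_ker, hf, Ideal.Quotient.eq_zero_iff_mem] at hr
    exact hJ' r hr
  · refine Module.length_le_of_surjective
      ((LinearMap.range f).liftQ (Submodule.factor hJ) ?_) ?_
    · rintro _ ⟨r, rfl⟩
      rw [LinearMap.mem_ker, hf]
      exact Ideal.Quotient.eq_zero_iff_mem.2 (Q.mul_mem_right r hx)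
    · rw [← LinearMap.range_eq_top, Submodule.range_liftQ, LinearMap.range_eq_top]
      exact Submodule.factor_surjective hJ

variable [IsNoetherianRing R]

/-- A consequence of the Artin–Rees lemma: division by an element outside a prime `P` shifts the
`I`-adic filtration of `R ⧸ P` by a bounded amount. -/
lemma exists_mem_sup_pow_of_mul_mem (I P : Ideal R) [hP : P.IsPrime] {x : R} (hx : x ∉ P) :
    ∃ k : ℕ, ∀ n r, k ≤ n → x * r ∈ P ⊔ I ^ n → r ∈ P ⊔ I ^ (n - k) := by
  obtain ⟨k, hk⟩ := Ideal.exists_pow_inf_eq_pow_smul I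
    (Submodule.span R {(Ideal.Quotient.mk P x : R ⧸ P)})
  refine ⟨k, fun n r hn hr => ?_⟩
  obtain ⟨p, hp, a, ha, hpa⟩ := Submodule.mem_sup.1 hr
  have h1 : Ideal.Quotient.mk P (x * r) ∈
      (I ^ n • ⊤ ⊓ Submodule.span R {Ideal.Quotient.mk P x} : Submodule R (R ⧸ P)) := by
    constructor
    · have : Ideal.Quotient.mk P (x * r) = a • (1 : R ⧸ P) := by
        rw [← hpa, map_add, Ideal.Quotient.eq_zero_iff_mem.2 hp, zero_add, Algebra.smul_def, mul_one]
        rfl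
      rw [this]
      exact Submodule.smul_mem_smul ha trivial
    · refine Submodule.mem_span_singleton.2 ⟨r, ?_⟩
      rw [mul_comm, map_mul, Algebra.smul_def]
      rfl
  rw [hk n hn] at h1
  obtain ⟨b, hb, hbx⟩ := Submodule.mem_smul_span_singleton.1
    (Submodule.smul_mono (le_refl (I ^ (n - k))) inf_le_right h1)
  have h2 : x * (r - b) ∈ P := by
    rw [mul_sub, ← Ideal.Quotient.mk_eq_mk_iff_sub_mem, ← hbx, mul_comm, map_mul, Algebra.smul_def]
    rfl
  have h3 : r - b ∈ P := (hP.mem_or_mem h2).resolve_left hx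
  simpa using add_mem (Ideal.mem_sup_left (T := I ^ (n - k)) h3) (Ideal.mem_sup_right hb)

variable [IsLocalRing R]

/-- The Hilbert–Samuel function of `R ⧸ P` grows at least like `n ^ d`, if there is a chain of
primes of length `d` starting at `P`. -/
theorem exists_pow_le_mul_length_of_ltSeries (d : ℕ) : ∀ s : LTSeries (PrimeSpectrum R),
    s.length = d → ∃ K : ℕ, ∀ n : ℕ, 1 ≤ n →
      ((n ^ d : ℕ) : ℕ∞) ≤ K * Module.length R (R ⧸ (s.head.asIdeal ⊔ maximalIdeal R ^ n)) := by
  have hone : ∀ (P : PrimeSpectrum R) (n : ℕ), 1 ≤ n →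
      1 ≤ Module.length R (R ⧸ (P.asIdeal ⊔ maximalIdeal R ^ n)) := by
    intro P n hn
    have : Nontrivial (R ⧸ (P.asIdeal ⊔ maximalIdeal R ^ n)) := by
      refine Ideal.Quotient.nontrivial_iff.2 (ne_top_of_le_ne_top
        (maximalIdeal.isMaximal R).ne_top (sup_le (le_maximalIdeal P.2.ne_top) ?_))
      exact Ideal.pow_le_self (by omega)
    exact Order.one_le_iff_pos.2 Module.length_pos
  induction d with
  | zero => exact fun s _ => ⟨1, fun n hn => by simpa using hone s.head n hn⟩
  | succ d ih =>
    intro s hs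
    have hs0 : s.length ≠ 0 := by omega
    obtain ⟨k, hk⟩ := ih (s.tail hs0) (by simp [hs])
    rw [RelSeries.head_tail] at hk
    have hlt : s.head < s 1 := s.strictMono (by
      rw [Fin.lt_def]
      simp [hs])
    obtain ⟨x, hxQ, hxP⟩ := SetLike.exists_of_lt
      (show s.head.asIdeal < (s 1).asIdeal from hlt)
    have : s.head.asIdeal.IsPrime := s.head.2
    obtain ⟨a, ha⟩ := exists_mem_sup_pow_of_mul_mem (maximalIdeal R) s.head.asIdeal hxP
    have hrec : ∀ n, a < n → Module.length R (R ⧸ (s.head.asIdeal ⊔ maximalIdeal R ^ (n - (a + 1)))) +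
        Module.length R (R ⧸ ((s 1).asIdeal ⊔ maximalIdeal R ^ n)) ≤
        Module.length R (R ⧸ (s.head.asIdeal ⊔ maximalIdeal R ^ n)) := fun n hn =>
      length_add_length_le (sup_le_sup_right hlt.le _) (Ideal.mem_sup_left hxQ) fun r hr =>
        (sup_le_sup_left (Ideal.pow_le_pow_right (show n - (a + 1) ≤ n - a by omega)) _ :
          s.head.asIdeal ⊔ maximalIdeal R ^ (n - a) ≤ _) (ha n r hn.le hr)
    -- The recursion `H(n) ≥ H(n - b) + n ^ d / k` needs a positive step `b`.
    obtain ⟨b, hb⟩ : ∃ b, b = a + 1 := ⟨_, rfl⟩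
    rw [← hb] at hrec
    refine ⟨b ^ (d + 1) + (d + 1) * b * k, fun n hn => ?_⟩
    induction n using Nat.strong_induction_on with
    | _ n ihn =>
      by_cases hnb : n ≤ b
      · calc ((n ^ (d + 1) : ℕ) : ℕ∞) ≤ ((b ^ (d + 1) + (d + 1) * b * k : ℕ) : ℕ∞) * 1 := by
              rw [mul_one]
              exact_mod_cast (Nat.pow_le_pow_left hnb _).trans (Nat.le_add_right _ _)
          _ ≤ _ := by gcongr; exact hone _ n hn
      · obtain ⟨m, rfl⟩ := Nat.exists_eq_add_of_lt (not_le.1 hnb)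
        have h1 := hrec (b + m + 1) (by omega)
        have h2 := hk (b + m + 1) hn
        have h3 := ihn (m + 1) (by omega) (by omega)
        rw [show b + m + 1 - b = m + 1 by omega] at h1
        have h4 : (((b + m + 1) ^ (d + 1) : ℕ) : ℕ∞) ≤ ((m + 1) ^ (d + 1) : ℕ) +
            ((d + 1) * b : ℕ) * (((b + m + 1) ^ d : ℕ) : ℕ∞) := by
          have := add_pow_succ_le_pow_add (m + 1) b d
          rw [show m + 1 + b = b + m + 1 by ring] at this
          exact_mod_cast this
        refine h4.trans ?_
        refine le_trans ?_ (mul_le_mul_right h1 _)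
        rw [mul_add]
        refine add_le_add h3 ((mul_le_mul_right h2 _).trans ?_)
        rw [← mul_assoc]
        refine mul_le_mul_left ?_ _
        exact_mod_cast Nat.le_add_left _ _

/-- The lower bound for the Hilbert–Samuel function in terms of the Krull dimension. -/
theorem exists_pow_le_mul_length_quotient_pow {d : ℕ} (hd : ringKrullDim R = d) :
    ∃ K : ℕ, ∀ n : ℕ, 1 ≤ n →
      ((n ^ d : ℕ) : ℕ∞) ≤ K * Module.length R (R ⧸ maximalIdeal R ^ n) := by
  obtain ⟨s, hs⟩ := Order.le_krullDim_iff.1 hd.ge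
  obtain ⟨K, hK⟩ := exists_pow_le_mul_length_of_ltSeries d s hs
  refine ⟨K, fun n hn => (hK n hn).trans (mul_le_mul_right ?_ _)⟩
  exact Module.length_le_of_surjective (Submodule.factor le_sup_right)
    (Submodule.factor_surjective _)

end HilbertSamuel

/-! ### The lower bound for the complexity of iterated pushforwards -/

section LowerBound

open DerivedCategory

variable {R : Type u} [CommRing R] [IsNoetherianRing R]
  [HasDerivedCategory.{w} (FGModuleCat.{u} R)]

noncomputable instance (φ : R →+* R) (hf : φ.Finite) : (pushforward φ hf).CommShift ℤ := by
  unfold pushforward; infer_instance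

instance (φ : R →+* R) (hf : φ.Finite) : (pushforward φ hf).IsTriangulated := by
  unfold pushforward; infer_instance

/-- A finitely generated module, as an object of `D^b(R)` in degree zero. -/
noncomputable def dbSingle (M : FGModuleCat.{u} R) : DbMod R :=
  ⟨(singleFunctor _ 0).obj M, ⟨0, inferInstance⟩, ⟨0, inferInstance⟩⟩

lemma nonempty_iterate_pushforward_dbSingle_iso (φ : R →+* R) (hf : φ.Finite) (e : ℕ)
    (M : FGModuleCat.{u} R) : Nonempty ((pushforward φ hf).obj^[e] (dbSingle M) ≅
      dbSingle ((fgPushforward φ hf).obj^[e] M)) := by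
  induction e with
  | zero => exact ⟨Iso.refl _⟩
  | succ e ih =>
    obtain ⟨i⟩ := ih
    rw [Function.iterate_succ_apply', Function.iterate_succ_apply']
    refine ⟨(pushforward φ hf).mapIso i ≪≫ ObjectProperty.isoMk _ ?_⟩
    exact ((fgPushforward φ hf).mapDerivedCategorySingleFunctor 0).app _

variable [IsLocalRing R]

/-- Hom from the Koszul complex on generators of the maximal ideal yields a functional which is
finite on `D^b(R)` and which on a module `N` is bounded below by the length of `N ⧸ 𝔪 N`. -/
lemma exists_isShiftSubadditive_koszul (t : ℝ) : ∃ (f : DbMod R → ℝ≥0∞) (c : ℝ≥0∞),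
    IsShiftSubadditive t f ∧ (∀ X, f X ≠ ∞) ∧ c ≠ 0 ∧ ∀ N : FGModuleCat.{u} R,
      c * ((Module.length R (N ⧸ (maximalIdeal R • ⊤ : Submodule R N)) : ℕ∞) : ℝ≥0∞) ≤
        f (dbSingle N) := by
  obtain ⟨s, hs⟩ := IsNoetherian.noetherian (maximalIdeal R)
  have hl : Ideal.ofList s.toList = maximalIdeal R := by
    rw [← hs, Ideal.ofList]
    simp [Ideal.span]
  obtain ⟨P, hP, hnil, htop⟩ :=
    exists_koszul (R := R) ((singleFunctor _ 0).obj (FGModuleCat.of R R)) s.toList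
  refine ⟨fun X => homWeight R t P X.obj,
    ENNReal.ofReal (Real.exp (-(((s.toList.length : ℕ) : ℤ) * t))),
    (isShiftSubadditive_homWeight R t P).comp (Bounded.ι), fun X => ?_, by simp [Real.exp_pos],
    fun N => ?_⟩
  · have h := hP X.obj (isHomNoetherian_of_bounded R X.property)
    refine homWeight_ne_top h (fun i => ?_) t
    have := h.isNoetherian i
    refine length_ne_top_of_le_radical_annihilator (I := maximalIdeal R)
      (maximalIdeal.isMaximal R).isPrime.radical ?_
    rw [← hl, Ideal.ofList, Ideal.span_le]
    intro x hx
    obtain ⟨n, hn⟩ := hnil x hx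
    refine ⟨n, Module.mem_annihilator.2 fun g => ?_⟩
    rw [← Category.id_comp g, ← Linear.smul_comp, hn, zero_comp]
  · obtain ⟨-, g, hg, hker⟩ := htop ((singleFunctor _ 0).obj N) fun i hi =>
      subsingleton_hom_single_shift R N i hi.ne'
    refine le_trans (mul_le_mul_right (ENat.toENNReal_le.2 ?_) _)
      (le_homWeight R t P _ (s.toList.length : ℤ))
    rw [hl] at hker
    change _ ≤ Module.length R (P ⟶ ((singleFunctor _ 0).obj N)⟦(s.toList.length : ℤ)⟧)
    rw [← (g.quotKerEquivOfSurjective hg).length_eq]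
    have q := Submodule.Quotient.equiv (maximalIdeal R • ⊤) (maximalIdeal R • ⊤)
      (singleHomEquiv R N) (by rw [Submodule.map_smul'', Submodule.map_top, LinearEquiv.range])
    rw [← q.length_eq]
    exact Module.length_le_of_surjective (Submodule.factor hker) (Submodule.factor_surjective hker)

/-- The lower bound for the complexities of the iterates of a finite local endomorphism. -/
theorem exists_mul_length_le_iterComplexity {φ : R →+* R} [IsLocalHom φ]
    (hφ : IsOfFiniteLength φ) (hf : φ.Finite) (t : ℝ) {G : DbMod R} (hG : IsSplitGenerator G) :
    ∃ c : ℝ, 0 < c ∧ ∀ e : ℕ, ENNReal.ofReal (c * ((residueDegree φ : ℝ) ^ e *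
      (Module.length R (R ⧸ (maximalIdeal R).map (φ ^ e))).toNat)) ≤
        iterComplexity (pushforward φ hf) t G e := by
  obtain ⟨f, w, hsub, hfin, hw, hlow⟩ := exists_isShiftSubadditive_koszul (R := R) t
  let R₀ : DbMod R := dbSingle (FGModuleCat.of R R)
  let Φ := pushforward φ hf
  have hGfin := complexity_ne_top t hG
  have key : ∀ e : ℕ, w * ((Module.length R (R ⧸ (maximalIdeal R).map (φ ^ e)) *
      (residueDegree φ : ℕ∞) ^ e : ℕ∞) : ℝ≥0∞) ≤
        iterComplexity Φ t G e * (complexity t G R₀ * f G) := by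
    intro e
    obtain ⟨i⟩ := nonempty_iterate_pushforward_dbSingle_iso φ hf e (FGModuleCat.of R R)
    have h1 := (hlow _).trans (hsub.retract_le (.ofIso i.symm))
    rw [length_iterate_fgPushforward_quotient, smul_eq_mul, Ideal.mul_top] at h1
    refine h1.trans ?_
    have h2 := hsub.div_le_complexity G (Φ.obj^[e] R₀)
    rw [ENNReal.div_le_iff_le_mul (.inr (hGfin _)) (.inl (hfin G))] at h2
    refine h2.trans ?_
    rw [← mul_assoc]
    gcongr
    have h3 := complexity_iterate_le t Φ G R₀ e
    exact (complexity_le_mul t (hGfin _) (h3.trans_lt (lt_top_iff_ne_top.2 (hGfin _))).ne).trans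
      (mul_le_mul_right h3 _)
  -- Truncating the constant at `1` keeps it finite even if `f G` or `δ_t(G, R₀)` vanishes.
  let c : ℝ≥0∞ := min (w / (complexity t G R₀ * f G)) 1
  have hc0 : c ≠ 0 :=
    (lt_min (ENNReal.div_pos hw (ENNReal.mul_ne_top (hGfin _) (hfin G))) one_pos).ne'
  have hc : c ≠ ∞ := ((min_le_right _ _).trans_lt ENNReal.one_lt_top).ne
  refine ⟨c.toReal, ENNReal.toReal_pos hc0 hc, fun e => ?_⟩
  have h := key e
  obtain ⟨n, hn⟩ := ENat.ne_top_iff_exists.1 (length_quotient_map_pow_ne_top hφ e)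
  rw [← hn] at h ⊢
  rw [ENNReal.ofReal_mul ENNReal.toReal_nonneg, ENNReal.ofReal_toReal hc]
  calc c * ENNReal.ofReal ((residueDegree φ : ℝ) ^ e * (n : ℕ∞).toNat)
      ≤ w / (complexity t G R₀ * f G) * ((n * (residueDegree φ : ℕ∞) ^ e : ℕ∞) : ℝ≥0∞) := by
        refine mul_le_mul' (min_le_left _ _) (le_of_eq ?_)
        have h1 : (n * (residueDegree φ : ℕ∞) ^ e : ℕ∞) = ((residueDegree φ ^ e * n : ℕ) : ℕ∞) := by
          push_cast; ring
        rw [h1, ENat.toENNReal_coe, ← ENNReal.ofReal_natCast]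
        push_cast
        simp
    _ ≤ iterComplexity Φ t G e := by
        rw [← ENNReal.mul_div_right_comm]
        exact ENNReal.div_le_of_le_mul h

end LowerBound

/-! ### The comparison of the entropies -/

theorem theorem3p2 (R : Type u) [CommRing R] [IsNoetherianRing R] [IsLocalRing R]
    [HasDerivedCategory.{w} (FGModuleCat.{u} R)]
    (d ν : ℕ) (hd : ringKrullDim R = d)
    (hν : Module.finrank (ResidueField R) (CotangentSpace R) = ν)
    (φ : R →+* R) [IsLocalHom φ] (hφ : IsOfFiniteLength φ) (hfin : φ.Finite)
    (hgen : ∃ G : DbMod R, IsSplitGenerator G) :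
    -- the local entropy is a well-defined limit
    Tendsto (localEntropySeq φ) atTop (𝓝 (localEntropy φ)) ∧
    (∀ t : ℝ,
      -- the categorical entropy is a well-defined limit, the same for every split generator
      (∀ G : DbMod R, IsSplitGenerator G →
        Tendsto (fun n : ℕ =>
            ENNReal.log (iterComplexity (pushforward φ hfin) t G n) / (n : EReal)) atTop
          (𝓝 (categoricalEntropy hgen (pushforward φ hfin) t))) ∧
      ((localEntropy φ + Real.log (residueDegree φ) : ℝ) : EReal) ≤
        categoricalEntropy hgen (pushforward φ hfin) t) ∧
    (∀ u : ℕ, 1 ≤ u →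
      (∀ᶠ e : ℕ in atTop,
        maximalIdeal R ^ (ν * u ^ e) ≤ (maximalIdeal R).map (φ ^ e) ∧
        (maximalIdeal R).map (φ ^ e) ≤ maximalIdeal R ^ (u ^ e)) →
      ∀ (t : ℝ) (G : DbMod R), IsSplitGenerator G →
        ∃ C : ℝ, 0 < C ∧ ∀ᶠ e : ℕ in atTop,
          ENNReal.ofReal (C * ((residueDegree φ : ℝ) * (u : ℝ) ^ d) ^ e) ≤
            iterComplexity (pushforward φ hfin) t G e) := by
  have hD : (1 : ℝ) ≤ residueDegree φ := by exact_mod_cast residueDegree_pos φ hfin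
  -- The integers `ℓ(R ⧸ φ^e(𝔪)R)`.
  obtain ⟨a, ha⟩ : ∃ a : ℕ → ℕ, ∀ e,
      (a e : ℕ∞) = Module.length R (R ⧸ (maximalIdeal R).map (φ ^ e)) :=
    ⟨_, fun e => ENat.natCast_toNat (length_quotient_map_pow_ne_top hφ e)⟩
  have ha1 : ∀ e, (1 : ℝ) ≤ a e := fun e => by
    have := one_le_length_quotient_map_pow φ e
    rw [← ha] at this
    exact_mod_cast this
  have hlow : ∀ (t : ℝ) (G : DbMod R), IsSplitGenerator G → ∃ c : ℝ, 0 < c ∧ ∀ e : ℕ,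
      ENNReal.ofReal (c * ((residueDegree φ : ℝ) ^ e * a e)) ≤
        iterComplexity (pushforward φ hfin) t G e := by
    intro t G hG
    obtain ⟨c, hc, hle⟩ := exists_mul_length_le_iterComplexity hφ hfin t hG
    refine ⟨c, hc, fun e => ?_⟩
    have := hle e
    rwa [← ha, ENat.toNat_natCast] at this
  have hpos : ∀ (t : ℝ) (G : DbMod R), IsSplitGenerator G →
      ∃ c : ℝ≥0∞, c ≠ 0 ∧ ∀ n, c ≤ iterComplexity (pushforward φ hfin) t G n := by
    intro t G hG
    obtain ⟨c, hc, hle⟩ := hlow t G hG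
    refine ⟨ENNReal.ofReal c, by simpa using hc, fun n => le_trans ?_ (hle n)⟩
    refine ENNReal.ofReal_le_ofReal (le_mul_of_one_le_right hc.le ?_)
    exact one_le_mul_of_one_le_of_one_le (one_le_pow₀ hD) (ha1 n)
  have hloc := tendsto_localEntropySeq hφ
  refine ⟨hloc, fun t => ?_, fun u hu hue t G hG => ?_⟩
  · obtain ⟨h, hh, hlim⟩ := exists_categoricalEntropy_eq hgen (pushforward φ hfin) t (hpos t)
    rw [hh]
    constructor
    · intro G hG
      obtain ⟨c, hc, hcn⟩ := hpos t G hG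
      exact tendsto_log_ennreal_div (fun n => ((pos_iff_ne_zero.2 hc).trans_le (hcn n)).ne')
        (fun n => complexity_ne_top t hG _) (hlim G hG)
    · obtain ⟨G, hG⟩ := hgen
      obtain ⟨c, hc, hle⟩ := hlow t G hG
      rw [EReal.coe_le_coe_iff]
      have h1 := (tendsto_const_div_atTop_nhds_zero_nat (Real.log c)).add
        (hloc.add_const (Real.log (residueDegree φ)))
      rw [zero_add] at h1
      refine le_of_tendsto_of_tendsto h1 (hlim G hG) ?_
      filter_upwards [eventually_ge_atTop 1] with e he
      have hDe : (0 : ℝ) < (residueDegree φ : ℝ) ^ e := by positivity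
      have hae : (0 : ℝ) < a e := zero_lt_one.trans_le (ha1 e)
      have he0 : (e : ℝ) ≠ 0 := by positivity
      have h2 : c * ((residueDegree φ : ℝ) ^ e * a e) ≤
          (iterComplexity (pushforward φ hfin) t G e).toReal :=
        (ENNReal.ofReal_le_iff_le_toReal (complexity_ne_top t hG _)).1 (hle e)
      have h3 := Real.log_le_log (by positivity) h2
      rw [Real.log_mul hc.ne' (by positivity), Real.log_mul hDe.ne' hae.ne', Real.log_pow] at h3
      rw [localEntropySeq, ← ha, ENat.toNat_natCast]
      calc Real.log c / e + (Real.log (a e) / e + Real.log (residueDegree φ))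
          = (Real.log c + (e * Real.log (residueDegree φ) + Real.log (a e))) / e := by
            field_simp
            ring
        _ ≤ _ := by gcongr
  · obtain ⟨c, hc, hle⟩ := hlow t G hG
    obtain ⟨K, hK⟩ := exists_pow_le_mul_length_quotient_pow hd
    have hK0 : 0 < K := Nat.pos_of_ne_zero fun h0 => by simpa [h0] using hK 1 le_rfl
    refine ⟨c / K, by positivity, ?_⟩
    filter_upwards [hue] with e he
    refine le_trans (ENNReal.ofReal_le_ofReal ?_) (hle e)
    have h1 : ((u ^ e) ^ d : ℕ) ≤ K * a e := by
      have h2 := (hK (u ^ e) (Nat.one_le_pow _ _ hu)).trans (mul_le_mul_right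
        (Module.length_le_of_surjective (Submodule.factor he.2) (Submodule.factor_surjective _)) _)
      rw [← ha] at h2
      exact_mod_cast h2
    have h3 : ((u : ℝ) ^ d) ^ e ≤ K * a e := by
      rw [← pow_mul, mul_comm d, pow_mul]
      exact_mod_cast h1
    calc c / K * ((residueDegree φ : ℝ) * (u : ℝ) ^ d) ^ e
        = c / K * ((residueDegree φ : ℝ) ^ e * ((u : ℝ) ^ d) ^ e) := by rw [mul_pow]
      _ ≤ c / K * ((residueDegree φ : ℝ) ^ e * (K * a e)) := by gcongr
      _ = c * ((residueDegree φ : ℝ) ^ e * a e) := by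
        have : (K : ℝ) ≠ 0 := by positivity
        field_simp
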